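/- Let $k$ be a field of arbitrary characteristic, $V$ a finite-dimensional $k$-vector space and $G$ a finite group acting linearly on $V$. Let $A=S(V)\# G$ be the skew group algebra, graded with $\deg v=1$ for $v\in V$ and $\deg g=0$ for $g\in G$. Let $\kappa: A\otimes A\to A$ be a Hochschild 2-cocycle, i.e. a $k$-linear map with $$a\,\kappa(b\otimes c)+\kappa(a\otimes bc)=\kappa(ab\otimes c)+\kappa(a\otimes b)\,c\qquad (a,b,c\in A),$$ which is homogeneous of degree $-2$. Then $\kappa$ lifts to a deformation of $A$ over $k[t]$: there is an associative $k[t]$-bilinear product $*$ on $A[t]$ with unit $1_A$ such that $$a*b=ab+\mu_1(a\otimes b)\,t+\mu_2(a\otimes b)\,t^2+\cdots\quad(a,b\in A),\qquad \mu_1=\kappa .$$ Moreover, this deformation can be chosen so that it is realized by a Drinfeld-type algebra, in the following sense. The formula $\kappa_0(v,w)=\kappa(v\otimes w)-\kappa(w\otimes v)$ $(v,w\in V)$ defines an alternating bilinear map $\kappa_0:V\times V\to kG$. Let $\mathcal{H}_{0,\kappa_0}$ be the associative $k$-algebra generated by $V$ and $kG$ subject to the relations of $kG$ and $vw-wv=\kappa_0(v,w)$,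 $gv-({}^gv)g=0$ for $v,w\in V$, $g\in G$, filtered by $\deg v=1$, $\deg g=0$. Then $\mathcal{H}_{0,\kappa_0}$ has the Poincaré–Birkhoff–Witt property, i.e. $\operatorname{gr}\mathcal{H}_{0,\kappa_0}\cong S(V)\# G$ as graded algebras, and there is an isomorphism of $k$-algebras from $\mathcal{H}_{0,\kappa_0}$ to the fiber $(A[t],*)/(t-1)$ that sends each generator $v\in V$ and $g\in G$ to the class of $v$, respectively $g$. -/

import Mathlib

noncomputable section

namespace SkewGroupDeformation

open Polynomial

/-! ### The skew group algebra `S(V) # G` -/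

section SkewGroupAlgebra

variable (k : Type*) (G : Type*) (V : Type*) [Field k] [Group G] [AddCommGroup V] [Module k V]
  [DistribMulAction G V] [SMulCommClass G k V]

/-- The algebra endomorphism of `S(V)` induced by the linear action of `g` on `V`. -/
def symAct (g : G) : SymmetricAlgebra k V →ₐ[k] SymmetricAlgebra k V :=
  SymmetricAlgebra.lift (SymmetricAlgebra.ι k V ∘ₗ DistribSMul.toLinearMap k V g)

variable {G V}

theorem symAct_ι (g : G) (v : V) :
    symAct k G V g (SymmetricAlgebra.ι k V v) = SymmetricAlgebra.ι k V (g • v) := by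
  simp [symAct]

theorem symAct_one : symAct k G V (1 : G) = AlgHom.id k _ := by
  apply SymmetricAlgebra.algHom_ext
  ext v
  simp [symAct_ι]

theorem symAct_mul (g h : G) : symAct k G V (g * h) = (symAct k G V g).comp (symAct k G V h) := by
  apply SymmetricAlgebra.algHom_ext
  ext v
  simp [symAct_ι, mul_smul]

variable (G V)

/-- The group `G` acts on `S(V)` by algebra automorphisms extending its action on `V`. -/
instance symMulSemiringAction : MulSemiringAction G (SymmetricAlgebra k V) where
  smul g x := symAct k G V g x
  one_smul x := by
    change symAct k G V 1 x = x
    rw [symAct_one]; rfl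
  mul_smul g h x := by
    change symAct k G V (g * h) x = symAct k G V g (symAct k G V h x)
    rw [symAct_mul]; rfl
  smul_zero g := map_zero (symAct k G V g)
  smul_add g := map_add (symAct k G V g)
  smul_one g := map_one (symAct k G V g)
  smul_mul g := map_mul (symAct k G V g)

instance symSMulCommClass : SMulCommClass G k (SymmetricAlgebra k V) where
  smul_comm g c x := map_smul (symAct k G V g) c x

/-- The skew group algebra `S(V) # G`: finite sums `∑ r_g g` with `r_g ∈ S(V)`, multiplied by
`(r g) (s h) = r (g • s) (g h)`. -/
abbrev Skew : Type _ := SkewMonoidAlgebra (SymmetricAlgebra k V) G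

variable {V} in
/-- A vector of `V` as an element of `S(V) # G`. -/
def vec (v : V) : Skew k G V := SkewMonoidAlgebra.single 1 (SymmetricAlgebra.ι k V v)

/-- The inclusion of the group algebra `kG` in `S(V) # G`. -/
def groupIncl : MonoidAlgebra k G →ₐ[k] Skew k G V :=
  MonoidAlgebra.lift k (Skew k G V) G (SkewMonoidAlgebra.of (SymmetricAlgebra k V) G)

/-- The homogeneous component of degree `n` of `S(V) # G` (vectors in degree 1, group elements in
degree 0): all coefficients lie in the `n`-th symmetric power of `V` in `S(V)`. -/
def gradedPiece (n : ℕ) : Submodule k (Skew k G V) where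
  carrier := {x | ∀ g : G, x.coeff g ∈ (LinearMap.range (SymmetricAlgebra.ι k V)) ^ n}
  zero_mem' g := by simp
  add_mem' ha hb g := by simpa using Submodule.add_mem _ (ha g) (hb g)
  smul_mem' c x hx g := by simpa using Submodule.smul_mem _ c (hx g)

/-- The homogeneous components indexed by integers; those of negative degree vanish. -/
def gradedPieceInt : ℤ → Submodule k (Skew k G V)
  | Int.ofNat n => gradedPiece k G V n
  | Int.negSucc _ => ⊥

variable {k G V} in
/-- A bilinear map on `S(V) # G` (a Hochschild 2-cochain) of graded degree `d`. -/
def IsHomogeneousOfDegree (μ : Skew k G V →ₗ[k] Skew k G V →ₗ[k] Skew k G V) (d : ℤ) : Prop :=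
  ∀ m n : ℕ, ∀ a ∈ gradedPiece k G V m, ∀ b ∈ gradedPiece k G V n,
    μ a b ∈ gradedPieceInt k G V (m + n + d)

end SkewGroupAlgebra

/-! ### Hochschild 2-cocycles and deformations over `k[t]` -/

section Deformation

variable (k : Type*) (A : Type*) [Field k] [Ring A] [Algebra k A]

variable {k A} in
/-- Hochschild 2-cocycles of `A` with coefficients in `A`, on the bar resolution. -/
def IsHochschildTwoCocycle (μ : A →ₗ[k] A →ₗ[k] A) : Prop :=
  ∀ a b c : A, a * μ b c + μ a (b * c) = μ (a * b) c + μ a b * c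

/-- A deformation of `A` over `k[t]`: an associative `k[t]`-bilinear product `*` on `A[t]`, with
unit `1_A`, such that `a * b ≡ a b` modulo `t` for `a, b ∈ A`. By bilinearity the product is
determined by the expansions `a * b = a b + μ₁(a, b) t + μ₂(a, b) t² + ⋯`, which are finite sums
because they are elements of `A[t]`. -/
structure Deformation where
  mul : PolynomialModule k A →ₗ[k[X]] PolynomialModule k A →ₗ[k[X]] PolynomialModule k A
  mul_assoc : ∀ x y z, mul (mul x y) z = mul x (mul y z)
  one_mul : ∀ x, mul (PolynomialModule.single k 0 1) x = x
  mul_one : ∀ x, mul x (PolynomialModule.single k 0 1) = x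
  coeff_zero : ∀ a b : A,
    (mul (PolynomialModule.single k 0 a) (PolynomialModule.single k 0 b)).coeff 0 = a * b

namespace Deformation

variable {k A} (D : Deformation k A)

/-- The `j`-th multiplication map `μ_j`: the coefficient of `t ^ j` in `a * b`. -/
def mulMap (j : ℕ) : A →ₗ[k] A →ₗ[k] A :=
  LinearMap.mk₂ k
    (fun a b => (D.mul (PolynomialModule.lsingle k 0 a) (PolynomialModule.lsingle k 0 b)).coeff j)
    (fun a a' b => by simp)
    (fun c a b => by
      rw [map_smul, LinearMap.map_smul_of_tower, LinearMap.smul_apply]; rfl)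
    (fun a b b' => by simp)
    (fun c a b => by
      rw [map_smul, LinearMap.map_smul_of_tower]; rfl)

/-- The deformed algebra `A_t`: the `k[t]`-module `A[t]` with the product of the deformation. -/
def Total (_D : Deformation k A) : Type _ := PolynomialModule k A

instance : AddCommGroup D.Total := inferInstanceAs (AddCommGroup (PolynomialModule k A))

instance : Module k[X] D.Total := inferInstanceAs (Module k[X] (PolynomialModule k A))

instance : Module k D.Total := inferInstanceAs (Module k (PolynomialModule k A))

instance : IsScalarTower k k[X] D.Total :=
  inferInstanceAs (IsScalarTower k k[X] (PolynomialModule k A))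

instance : Ring D.Total :=
  { (inferInstance : AddCommGroup D.Total) with
    mul := fun x y => D.mul x y
    one := PolynomialModule.single k 0 1
    mul_assoc := D.mul_assoc
    one_mul := D.one_mul
    mul_one := D.mul_one
    left_distrib := fun x y z => map_add (D.mul x) y z
    right_distrib := fun x y z => LinearMap.map_add₂ D.mul x y z
    zero_mul := fun x => LinearMap.map_zero₂ D.mul x
    mul_zero := fun x => map_zero (D.mul x) }

instance : Algebra k[X] D.Total :=
  Algebra.ofModule (fun r x y => LinearMap.map_smul₂ D.mul r x y)
    (fun r x y => map_smul (D.mul x) r y)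

instance : Algebra k D.Total :=
  Algebra.ofModule
    (fun r x y => by
      rw [← algebraMap_smul k[X] r x, ← algebraMap_smul k[X] r (x * y), smul_mul_assoc])
    (fun r x y => by
      rw [← algebraMap_smul k[X] r y, ← algebraMap_smul k[X] r (x * y), mul_smul_comm])

/-- The fiber `A_t |_{t = c} = A_t / (t - c) A_t`. -/
abbrev Fiber (c : k) : Type _ :=
  RingQuot (fun x y : D.Total => x = algebraMap k[X] D.Total X ∧ y = algebraMap k[X] D.Total (C c))

/-- The map `A ⊆ A[t] = A_t → A_t |_{t = c}`. -/
def toFiber (c : k) (a : A) : D.Fiber c :=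
  RingQuot.mkAlgHom k _ (show D.Total from PolynomialModule.single k 0 a)

end Deformation

end Deformation

/-! ### The algebras `H_{λ,κ}` -/

section Hecke

variable {k : Type*} {G : Type*} {V : Type*} [Field k] [Group G] [AddCommGroup V] [Module k V]
  [DistribMulAction G V]

/-- A vector as an element of the free algebra on `V` and `G`. -/
def freeVec (k G : Type*) {V : Type*} [Field k] (v : V) : FreeAlgebra k (V ⊕ G) :=
  FreeAlgebra.ι k (Sum.inl v)

/-- An element `∑ c_g g` of `kG` as an element of the free algebra on `V` and `G`. -/
def freeGrp {k G : Type*} (V : Type*) [Field k] (x : MonoidAlgebra k G) : FreeAlgebra k (V ⊕ G) :=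
  x.coeff.sum fun g c => c • FreeAlgebra.ι k (Sum.inr g)

/-- The defining relations of `H_{λ,κ}`: linear relations in `V`, relations of the group algebra,
and `v w - w v = κ(v, w)`, `g v - (g • v) g = λ(g, v)`. -/
inductive HeckeRel (lam : MonoidAlgebra k G →ₗ[k] V →ₗ[k] MonoidAlgebra k G)
    (κ : V →ₗ[k] V →ₗ[k] MonoidAlgebra k G) :
    FreeAlgebra k (V ⊕ G) → FreeAlgebra k (V ⊕ G) → Prop
  | vec_add (v w : V) : HeckeRel lam κ (freeVec k G (v + w)) (freeVec k G v + freeVec k G w)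
  | vec_smul (c : k) (v : V) : HeckeRel lam κ (freeVec k G (c • v)) (c • freeVec k G v)
  | grp_one : HeckeRel lam κ (freeGrp V (MonoidAlgebra.single 1 1)) 1
  | grp_mul (g h : G) : HeckeRel lam κ (freeGrp V (MonoidAlgebra.single (g * h) 1))
      (freeGrp V (MonoidAlgebra.single g 1) * freeGrp V (MonoidAlgebra.single h 1))
  | comm (v w : V) : HeckeRel lam κ
      (freeVec k G v * freeVec k G w - freeVec k G w * freeVec k G v) (freeGrp V (κ v w))
  | act (g : G) (v : V) : HeckeRel lam κ
      (freeGrp V (MonoidAlgebra.single g 1) * freeVec k G v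
        - freeVec k G (g • v) * freeGrp V (MonoidAlgebra.single g 1))
      (freeGrp V (lam (MonoidAlgebra.single g 1) v))

variable (lam : MonoidAlgebra k G →ₗ[k] V →ₗ[k] MonoidAlgebra k G)
  (κ : V →ₗ[k] V →ₗ[k] MonoidAlgebra k G)

/-- The algebra `H_{λ,κ}`. -/
def Hecke : Type _ := RingQuot (HeckeRel lam κ)

namespace Hecke

instance : Semiring (Hecke lam κ) := inferInstanceAs (Semiring (RingQuot (HeckeRel lam κ)))

instance : Algebra k (Hecke lam κ) := inferInstanceAs (Algebra k (RingQuot (HeckeRel lam κ)))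

instance : Ring (Hecke lam κ) := Algebra.semiringToRing k

/-- The generators of `H_{λ,κ}`: vectors of `V` and elements of `G`. -/
def gen (x : V ⊕ G) : Hecke lam κ := RingQuot.mkAlgHom k (HeckeRel lam κ) (FreeAlgebra.ι k x)

/-- The filtration of `H_{λ,κ}` by degree: `filtration n` is spanned by the words in the
generators with at most `n` letters from `V`. -/
def filtration (n : ℕ) : Submodule k (Hecke lam κ) :=
  Submodule.span k {x | ∃ w : List (V ⊕ G), w.countP Sum.isLeft ≤ n ∧ x = (w.map (gen lam κ)).prod}

theorem filtration_one_mem : (1 : Hecke lam κ) ∈ filtration lam κ 0 :=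
  Submodule.subset_span ⟨[], by simp, by simp⟩

theorem filtration_mul_mem {m n : ℕ} {a b : Hecke lam κ} (ha : a ∈ filtration lam κ m)
    (hb : b ∈ filtration lam κ n) : a * b ∈ filtration lam κ (m + n) := by
  have h := Submodule.mul_mem_mul ha hb
  rw [filtration, filtration, Submodule.span_mul_span] at h
  refine Submodule.span_mono ?_ h
  rintro _ ⟨_, ⟨w, hw, rfl⟩, _, ⟨w', hw', rfl⟩, rfl⟩
  exact ⟨w ++ w', by rw [List.countP_append]; omega, by simp⟩

/-- The next smaller step of the filtration (zero below degree 0). -/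
def filtrationPred : ℕ → Submodule k (Hecke lam κ)
  | 0 => ⊥
  | n + 1 => filtration lam κ n

/-- The degree `n` component of the associated graded algebra. -/
abbrev GrPiece (n : ℕ) : Type _ :=
  filtration lam κ n ⧸ (filtrationPred lam κ n).submoduleOf (filtration lam κ n)

/-- The class in degree `n` of the associated graded algebra of an element of `filtration n`. -/
def symbol (n : ℕ) (a : filtration lam κ n) : GrPiece lam κ n := Submodule.Quotient.mk a

/-- The Poincaré-Birkhoff-Witt property: the associated graded algebra of `H_{λ,κ}` is isomorphic
to `S(V) # G` as a graded algebra, i.e. there are linear isomorphisms in each degree, compatible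
with units and with products. (The product of the classes of `a` and `b` in the associated graded
algebra is the class of `a b`.) -/
def HasPBW [SMulCommClass G k V] : Prop :=
  ∃ e : ∀ n : ℕ, GrPiece lam κ n ≃ₗ[k] gradedPiece k G V n,
    (e 0 (symbol lam κ 0 ⟨1, filtration_one_mem lam κ⟩) : Skew k G V) = 1 ∧
    ∀ (m n : ℕ) (a : filtration lam κ m) (b : filtration lam κ n),
      (e (m + n) (symbol lam κ (m + n) ⟨a * b, filtration_mul_mem lam κ a.2 b.2⟩) : Skew k G V)
        = e m (symbol lam κ m a) * e n (symbol lam κ n b)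

end Hecke

end Hecke

end SkewGroupDeformation

end

open SkewGroupDeformation

/-! Let A = S(V) # G and let E = A ⊕ Aε be the square-zero extension defined by κ. For degree
reasons κ vanishes on two group elements and on a group element and a vector, so V and G lift to E
with their relations intact, except that [v, w] = κ₀(v, w) ε. Associativity of E gives the
conditions on κ₀: moving g past a commutator yields equivariance, and the Jacobi identity for
commutators yields the Jacobi condition (`isPBWForm_vectorForm`).

These conditions suffice for a Poincaré-Birkhoff-Witt theorem, proved by the diamond lemma for any
monoid M acting on V: sorted words followed by elements of M form a basis of T(V) # M modulo vw − wv
= κ(v, w) (`TensorSkew.normalForm_rel`, `SkewQuotient.ofNormalForm_bijective`). Nothing is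
symmetrized, so the characteristic plays no role. M = G gives the PBW property of H_{0,κ₀}. M = G ×
ℕ with the form κ₀ t gives an algebra H_t with a central parameter t, free over k[t] on the same
words as A over k. Hence H_t is A[t] as a module, and its product can be carried over to A[t].

Identifying A[t] with H_t by sorted words would give μ₁ = κ only up to a coboundary. To obtain κ
itself, use the algebra map H_t → E with t ↦ ε. It sends the sorted-word lift s(a) to a + f(a) ε,
where f lowers the degree by 2. The lift s − t·s∘f has no ε-term, and it still identifies A[t] with
H_t, because f is locally nilpotent and so 1 − t f is invertible (`polyExtend_bijective`). The
composite A[t] ≅ H_t → E is then reduction modulo t², so the new product agrees with that of E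
modulo t²: μ₁ = κ (`ParamQuotient.coeff_polyEquiv_symm`).

Since f vanishes on V and G, the generators keep their names, and setting t = 1 turns H_t into
H_{0,κ₀} (`ParamQuotient.fiberEquiv`). -/

noncomputable section

namespace SkewGroupDeformation

open Polynomial

/-! ### The skew monoid algebra `T(V) # M` of a tensor algebra -/

section TensorSkew

variable (k : Type*) (M : Type*) (V : Type*) [Field k] [Monoid M] [AddCommGroup V] [Module k V]
  [DistribMulAction M V] [SMulCommClass M k V]

/-- The algebra endomorphism of `T(V)` induced by the linear action of `g` on `V`. -/
def tensorAct (g : M) : TensorAlgebra k V →ₐ[k] TensorAlgebra k V :=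
  TensorAlgebra.lift k (TensorAlgebra.ι k ∘ₗ DistribSMul.toLinearMap k V g)

variable {M V}

theorem tensorAct_ι (g : M) (v : V) :
    tensorAct k M V g (TensorAlgebra.ι k v) = TensorAlgebra.ι k (g • v) := by
  simp [tensorAct]

theorem tensorAct_one : tensorAct k M V (1 : M) = AlgHom.id k _ := by
  apply TensorAlgebra.hom_ext
  ext v
  simp [tensorAct_ι]

theorem tensorAct_mul (g h : M) :
    tensorAct k M V (g * h) = (tensorAct k M V g).comp (tensorAct k M V h) := by
  apply TensorAlgebra.hom_ext
  ext v
  simp [tensorAct_ι, mul_smul]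

variable (M V)

instance tensorMulSemiringAction : MulSemiringAction M (TensorAlgebra k V) where
  smul g x := tensorAct k M V g x
  one_smul x := by
    change tensorAct k M V 1 x = x
    rw [tensorAct_one]; rfl
  mul_smul g h x := by
    change tensorAct k M V (g * h) x = tensorAct k M V g (tensorAct k M V h x)
    rw [tensorAct_mul]; rfl
  smul_zero g := map_zero (tensorAct k M V g)
  smul_add g := map_add (tensorAct k M V g)
  smul_one g := map_one (tensorAct k M V g)
  smul_mul g := map_mul (tensorAct k M V g)

instance tensorSMulCommClass : SMulCommClass M k (TensorAlgebra k V) where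
  smul_comm g c x := map_smul (tensorAct k M V g) c x

theorem smul_tensor_ι (g : M) (v : V) :
    g • TensorAlgebra.ι k v = TensorAlgebra.ι k (g • v) := tensorAct_ι k g v

/-- The skew monoid algebra `T(V) # M` as a skew monoid algebra of Mathlib. The type synonym
`TensorSkew` below carries the ring structure only. -/
abbrev RawSkew : Type _ := SkewMonoidAlgebra (TensorAlgebra k V) M

namespace RawSkew

variable {V} in
/-- The inclusion of `V` in `T(V) # M`. -/
def vec : V →ₗ[k] RawSkew k M V :=
  SkewMonoidAlgebra.lsingle k 1 ∘ₗ TensorAlgebra.ι k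

/-- The inclusion of `T(V)` in `T(V) # M`. -/
def tensorIncl : TensorAlgebra k V →ₐ[k] RawSkew k M V :=
  TensorAlgebra.lift k (vec k M)

variable {M} in
/-- The inclusion of `M` in `T(V) # M`. -/
def grp : M →* RawSkew k M V := SkewMonoidAlgebra.of (TensorAlgebra k V) M

theorem grp_mul_vec (g : M) (v : V) :
    grp k V g * vec k M v = vec k M (g • v) * grp k V g := by
  simp [grp, vec, SkewMonoidAlgebra.of_apply, SkewMonoidAlgebra.lsingle,
    SkewMonoidAlgebra.single_mul_single, smul_tensor_ι]

theorem tensorIncl_apply (x : TensorAlgebra k V) :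
    tensorIncl k M V x = SkewMonoidAlgebra.single 1 x := by
  let f : TensorAlgebra k V →ₐ[k] RawSkew k M V :=
    AlgHom.ofLinearMap (SkewMonoidAlgebra.lsingle k 1) rfl
      (fun x y => by simp [SkewMonoidAlgebra.lsingle, SkewMonoidAlgebra.single_mul_single])
  have : tensorIncl k M V = f := by
    apply TensorAlgebra.hom_ext
    ext v : 1
    simp [tensorIncl, vec]
    rfl
  rw [this]; rfl

theorem single_eq (g : M) (x : TensorAlgebra k V) :
    SkewMonoidAlgebra.single g x = tensorIncl k M V x * grp k V g := by
  simp [tensorIncl_apply, grp, SkewMonoidAlgebra.of_apply, SkewMonoidAlgebra.single_mul_single]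

variable {k M V}

section Lift

variable {E : Type*} [Ring E] [Algebra k E] (φ : V →ₗ[k] E) (ψ : M →* E)
  (h : ∀ g v, ψ g * φ v = φ (g • v) * ψ g)

-- It is enough to know the relation on vectors, since g passes through a product one factor at a
-- time. This is the compatibility that `SkewMonoidAlgebra.liftNCAlgHom` asks for.
include h in
theorem lift_comm (x : TensorAlgebra k V) (g : M) :
    TensorAlgebra.lift k φ (g • x) * ψ g = ψ g * TensorAlgebra.lift k φ x := by
  induction x using TensorAlgebra.induction with
  | algebraMap r =>
    have : g • algebraMap k (TensorAlgebra k V) r = algebraMap k _ r :=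
      (tensorAct k M V g).commutes r
    rw [this, AlgHom.commutes, Algebra.commutes]
  | ι v => rw [smul_tensor_ι, TensorAlgebra.lift_ι_apply, TensorAlgebra.lift_ι_apply, h]
  | mul a b ha hb =>
    rw [smul_mul', map_mul, map_mul, mul_assoc, hb, ← mul_assoc, ha, mul_assoc]
  | add a b ha hb => rw [smul_add, map_add, map_add, add_mul, mul_add, ha, hb]

/-- The universal property of `T(V) # M`. -/
def lift : RawSkew k M V →ₐ[k] E :=
  SkewMonoidAlgebra.liftNCAlgHom (TensorAlgebra.lift k φ) ψ (fun {x y} => lift_comm φ ψ h x y)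

@[simp] theorem lift_vec (v : V) : lift φ ψ h (vec k M v) = φ v := by
  simp [lift, vec, SkewMonoidAlgebra.liftNCAlgHom, SkewMonoidAlgebra.liftNCRingHom,
    SkewMonoidAlgebra.lsingle]

@[simp] theorem lift_grp (g : M) : lift φ ψ h (grp k V g) = ψ g := by
  simp [lift, grp, SkewMonoidAlgebra.liftNCAlgHom, SkewMonoidAlgebra.liftNCRingHom,
    SkewMonoidAlgebra.of_apply]

end Lift

theorem hom_ext {E : Type*} [Ring E] [Algebra k E] {f f' : RawSkew k M V →ₐ[k] E}
    (hv : ∀ v, f (vec k M v) = f' (vec k M v)) (hg : ∀ g, f (grp k V g) = f' (grp k V g)) :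
    f = f' := by
  have h1 : f.comp (tensorIncl k M V) = f'.comp (tensorIncl k M V) := by
    apply TensorAlgebra.hom_ext
    ext v
    simpa [tensorIncl] using hv v
  ext x
  induction x using SkewMonoidAlgebra.induction_on with
  | zero => simp
  | single g x =>
    rw [single_eq, map_mul, map_mul, hg]
    congr 1
    exact DFunLike.congr_fun h1 x
  | add x y hx hy => rw [map_add, map_add, hx, hy]

variable {I : Type*} (b : Module.Basis I k V)

/-- The element `b_{i₁} ⋯ b_{iₙ} g` of `T(V) # M`. -/
def word (w : List I) (g : M) : RawSkew k M V :=
  (w.map fun i => vec k M (b i)).prod * grp k V g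

theorem tensorAlgebra_basis_apply (w : FreeMonoid I) :
    b.tensorAlgebra w = (w.toList.map fun i => TensorAlgebra.ι k (b i)).prod := by
  have : (FreeAlgebra.basisFreeMonoid k I w) =
      (w.toList.map fun i => FreeAlgebra.ι k i).prod := by
    induction w using FreeMonoid.inductionOn' with
    | one =>
      simp [FreeAlgebra.basisFreeMonoid, FreeAlgebra.equivMonoidAlgebraFreeMonoid,
        ← MonoidAlgebra.one_def]
    | of_mul i w ih =>
      rw [FreeMonoid.toList_of_mul, List.map_cons, List.prod_cons, ← ih]
      simp [FreeAlgebra.basisFreeMonoid, FreeAlgebra.equivMonoidAlgebraFreeMonoid]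
  simp only [Module.Basis.tensorAlgebra, Module.Basis.map_apply, this]
  simp [map_list_prod, Function.comp_def]

/-- The basis of `T(V) # M` which consists of the words in a basis of `V`, followed by an element
of `M`. -/
def basis : Module.Basis (List I × M) k (RawSkew k M V) :=
  ((Finsupp.basis fun _ : M => b.tensorAlgebra).map
    (SkewMonoidAlgebra.coeffLinearEquiv (S := k)).symm).reindex
    ((Equiv.sigmaEquivProd M (FreeMonoid I)).trans
      ((Equiv.prodComm _ _).trans (Equiv.prodCongr FreeMonoid.toList (Equiv.refl _))))

theorem basis_apply (w : List I) (g : M) : basis b (w, g) = word b w g := by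
  have h : basis b (w, g) = SkewMonoidAlgebra.single g (b.tensorAlgebra (FreeMonoid.ofList w)) := by
    simp [basis, SkewMonoidAlgebra.coeffLinearEquiv, SkewMonoidAlgebra.coeffAddEquiv]
  rw [h, single_eq, word, tensorAlgebra_basis_apply, map_list_prod]
  simp [tensorIncl, Function.comp_def]

end RawSkew

variable {k M V}

variable (k M V) in
/-- The skew monoid algebra `T(V) # M` as a bare `k`-algebra. -/
def TensorSkew : Type _ := RawSkew k M V

instance : Ring (TensorSkew k M V) := inferInstanceAs (Ring (RawSkew k M V))

instance : Algebra k (TensorSkew k M V) := inferInstanceAs (Algebra k (RawSkew k M V))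

namespace TensorSkew

variable (k M) in
/-- The inclusion of `V` in `T(V) # M`. -/
def vec : V →ₗ[k] TensorSkew k M V where
  toFun v := RawSkew.vec k M v
  map_add' := (RawSkew.vec k M).map_add
  map_smul' := (RawSkew.vec k M).map_smul

variable (k V) in
/-- The inclusion of `M` in `T(V) # M`. -/
def grp : M →* TensorSkew k M V where
  toFun g := RawSkew.grp k V g
  map_one' := (RawSkew.grp k V).map_one
  map_mul' := (RawSkew.grp k V).map_mul

variable (k M V) in
/-- The inclusion of the monoid algebra `kM` in `T(V) # M`. -/
def monoidIncl : MonoidAlgebra k M →ₐ[k] TensorSkew k M V :=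
  MonoidAlgebra.lift k (TensorSkew k M V) M (grp k V)

theorem grp_mul_vec (g : M) (v : V) :
    grp k V g * vec k M v = vec k M (g • v) * grp k V g :=
  RawSkew.grp_mul_vec k M V g v

section Lift

variable {E : Type*} [Ring E] [Algebra k E] (φ : V →ₗ[k] E) (ψ : M →* E)
  (h : ∀ g v, ψ g * φ v = φ (g • v) * ψ g)

/-- The universal property of `T(V) # M`. -/
def lift : TensorSkew k M V →ₐ[k] E where
  toFun x := RawSkew.lift φ ψ h x
  map_one' := map_one (RawSkew.lift φ ψ h)
  map_mul' := map_mul (RawSkew.lift φ ψ h)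
  map_zero' := map_zero (RawSkew.lift φ ψ h)
  map_add' := map_add (RawSkew.lift φ ψ h)
  commutes' := (RawSkew.lift φ ψ h).commutes

@[simp] theorem lift_vec (v : V) : lift φ ψ h (vec k M v) = φ v := RawSkew.lift_vec φ ψ h v

@[simp] theorem lift_grp (g : M) : lift φ ψ h (grp k V g) = ψ g := RawSkew.lift_grp φ ψ h g

@[simp] theorem lift_monoidIncl (x : MonoidAlgebra k M) :
    lift φ ψ h (monoidIncl k M V x) = MonoidAlgebra.lift k E M ψ x := by
  change ((lift φ ψ h).comp (monoidIncl k M V)) x = _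
  congr 1
  ext g
  simp [monoidIncl]

end Lift

theorem hom_ext {E : Type*} [Ring E] [Algebra k E] {f f' : TensorSkew k M V →ₐ[k] E}
    (hv : ∀ v, f (vec k M v) = f' (vec k M v)) (hg : ∀ g, f (grp k V g) = f' (grp k V g)) :
    f = f' :=
  RawSkew.hom_ext (f := f) (f' := f') hv hg

variable {I : Type*} (b : Module.Basis I k V)

/-- The element `b_{i₁} ⋯ b_{iₙ} g` of `T(V) # M`. -/
def word (w : List I) (g : M) : TensorSkew k M V :=
  (w.map fun i => vec k M (b i)).prod * grp k V g

/-- The basis of `T(V) # M` which consists of the words in a basis of `V`, followed by an element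
of `M`. -/
def basis : Module.Basis (List I × M) k (TensorSkew k M V) where
  repr :=
    { (RawSkew.basis (M := M) b).repr with
      map_add' := (RawSkew.basis (M := M) b).repr.map_add
      map_smul' := (RawSkew.basis (M := M) b).repr.map_smul }

theorem basis_apply (w : List I) (g : M) : basis b (w, g) = word b w g :=
  RawSkew.basis_apply b w g

end TensorSkew

end TensorSkew

end SkewGroupDeformation

end

/-! ### PBW forms, and the identities between the relations in T(V) # M -/

noncomputable section

namespace SkewGroupDeformation

open Polynomial

section PBW

variable {k : Type*} {M : Type*} {V : Type*} [Field k] [Monoid M] [AddCommGroup V] [Module k V]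
  [DistribMulAction M V]

/-- The conditions on a bilinear form with values in `kM` which make the algebra with relations
`v w - w v = κ(v, w)` satisfy the Poincaré-Birkhoff-Witt theorem. -/
structure IsPBWForm (κ : V →ₗ[k] V →ₗ[k] MonoidAlgebra k M) : Prop where
  alt : ∀ v, κ v v = 0
  equivariant : ∀ (g : M) (v w : V),
    MonoidAlgebra.single g 1 * κ v w = κ (g • v) (g • w) * MonoidAlgebra.single g 1
  jacobi : ∀ (g : M) (u v w : V), (κ v w).coeff g • (u - g • u) + (κ w u).coeff g • (v - g • v)
    + (κ u v).coeff g • (w - g • w) = 0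

variable [SMulCommClass M k V] (κ : V →ₗ[k] V →ₗ[k] MonoidAlgebra k M)

namespace TensorSkew

/-! ### Degrees in `T(V) # M` -/

variable (k M V) in
/-- The homogeneous component of degree `n` of `T(V) # M`. -/
def deg (n : ℕ) : Submodule k (TensorSkew k M V) :=
  Submodule.span k {x | ∃ (l : List V) (g : M), l.length = n ∧ x = (l.map (vec k M)).prod * grp k V g}

theorem grp_mul_prod_vec (g : M) (l : List V) :
    grp k V g * (l.map (vec k M)).prod = ((l.map (g • ·)).map (vec k M)).prod * grp k V g := by
  induction l with
  | nil => simp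
  | cons v l ih =>
    simp only [List.map_cons, List.prod_cons]
    rw [← mul_assoc, grp_mul_vec, mul_assoc, ih, mul_assoc]

/-- Moving g to the right past vectors replaces each v by g v and does not change their number. -/
theorem mul_mem_deg {m n : ℕ} {x y : TensorSkew k M V} (hx : x ∈ deg k M V m)
    (hy : y ∈ deg k M V n) : x * y ∈ deg k M V (m + n) := by
  have h := Submodule.mul_mem_mul hx hy
  rw [deg, deg, Submodule.span_mul_span] at h
  refine Submodule.span_mono ?_ h
  rintro _ ⟨_, ⟨l, g, hl, rfl⟩, _, ⟨l', g', hl', rfl⟩, rfl⟩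
  refine ⟨l ++ l'.map (g • ·), g * g', by simp [hl, hl'], ?_⟩
  simp only [List.map_append, List.prod_append, map_mul]
  rw [mul_assoc, ← mul_assoc (grp k V g), grp_mul_prod_vec]
  simp only [mul_assoc]

theorem grp_mem_deg (g : M) : grp k V g ∈ deg k M V 0 :=
  Submodule.subset_span ⟨[], g, by simp, by simp⟩

theorem vec_mem_deg (v : V) : vec k M v ∈ deg k M V 1 :=
  Submodule.subset_span ⟨[v], 1, by simp, by simp⟩

theorem monoidIncl_eq_sum (x : MonoidAlgebra k M) :
    monoidIncl k M V x = x.coeff.sum fun g c => c • grp k V g :=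
  MonoidAlgebra.lift_apply _ _

theorem monoidIncl_single (g : M) (c : k) :
    monoidIncl k M V (MonoidAlgebra.single g c) = c • grp k V g := by
  simp [monoidIncl]

theorem monoidIncl_mem_deg (x : MonoidAlgebra k M) : monoidIncl k M V x ∈ deg k M V 0 := by
  rw [monoidIncl_eq_sum]
  exact Submodule.sum_mem _ fun g _ => Submodule.smul_mem _ _ (grp_mem_deg g)

/-! ### The defining relations -/

/-- The element `v w - w v - κ(v, w)` of `T(V) # M`. -/
def rel : V →ₗ[k] V →ₗ[k] TensorSkew k M V :=
  LinearMap.mk₂ k (fun v w => vec k M v * vec k M w - vec k M w * vec k M v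
      - monoidIncl k M V (κ v w))
    (fun u v w => by simp only [map_add, LinearMap.add_apply]; noncomm_ring)
    (fun c v w => by simp [smul_sub])
    (fun u v w => by simp only [map_add]; noncomm_ring)
    (fun c v w => by simp [smul_sub])

theorem rel_apply (v w : V) : rel κ v w = vec k M v * vec k M w - vec k M w * vec k M v
    - monoidIncl k M V (κ v w) := rfl

variable {κ} (hκ : IsPBWForm κ)
include hκ

theorem rel_self (v : V) : rel κ v v = 0 := by simp [rel_apply, hκ.alt]

theorem rel_swap (v w : V) : rel κ v w = -rel κ w v := by
  have h := rel_self hκ (v + w)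
  simp only [map_add, LinearMap.add_apply, rel_self hκ, zero_add, add_zero] at h
  exact eq_neg_of_add_eq_zero_right h

/-- Equivariance of κ, in the form used for rewriting: an element of M standing to the left of a
relation can be moved to its right. -/
theorem grp_mul_rel (g : M) (v w : V) :
    grp k V g * rel κ v w = rel κ (g • v) (g • w) * grp k V g := by
  have h := congrArg (monoidIncl k M V) (hκ.equivariant g v w)
  rw [map_mul, map_mul, monoidIncl_single, one_smul] at h
  rw [rel_apply, rel_apply, mul_sub, mul_sub, sub_mul, sub_mul, h, ← mul_assoc, grp_mul_vec,
    mul_assoc, grp_mul_vec, ← mul_assoc, ← mul_assoc, grp_mul_vec, mul_assoc _ (grp k V g),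
    grp_mul_vec, ← mul_assoc]

/-- Since v g − g v = (v − g v) g, the sum can be written as a sum over g of vectors times g, and
the vector at g is the one that the Jacobi condition makes zero. -/
theorem jacobi_monoidIncl (u v w : V) :
    (vec k M u * monoidIncl k M V (κ v w) - monoidIncl k M V (κ v w) * vec k M u)
    + (vec k M v * monoidIncl k M V (κ w u) - monoidIncl k M V (κ w u) * vec k M v)
    + (vec k M w * monoidIncl k M V (κ u v) - monoidIncl k M V (κ u v) * vec k M w) = 0 := by
  classical
  set s := (κ v w).coeff.support ∪ (κ w u).coeff.support ∪ (κ u v).coeff.support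
  have key : ∀ (x : MonoidAlgebra k M) (y : V), x.coeff.support ⊆ s →
      vec k M y * monoidIncl k M V x - monoidIncl k M V x * vec k M y =
        ∑ g ∈ s, vec k M (x.coeff g • (y - g • y)) * grp k V g := by
    intro x y hx
    rw [monoidIncl_eq_sum, Finsupp.sum_of_support_subset _ hx _ (by simp), Finset.mul_sum,
      Finset.sum_mul, ← Finset.sum_sub_distrib]
    refine Finset.sum_congr rfl fun g _ => ?_
    simp only [mul_smul_comm, smul_mul_assoc, grp_mul_vec, map_smul, map_sub, sub_mul, smul_sub]
  have h1 : (κ v w).coeff.support ⊆ s := fun g hg => by simp [s, Finset.mem_union]; simp at hg; tauto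
  have h2 : (κ w u).coeff.support ⊆ s := fun g hg => by simp [s, Finset.mem_union]; simp at hg; tauto
  have h3 : (κ u v).coeff.support ⊆ s := fun g hg => by simp [s, Finset.mem_union]; simp at hg; tauto
  rw [key _ u h1, key _ v h2, key _ w h3, ← Finset.sum_add_distrib, ← Finset.sum_add_distrib]
  refine Finset.sum_eq_zero fun g _ => ?_
  rw [← add_mul, ← add_mul, ← map_add, ← map_add, hκ.jacobi, map_zero, zero_mul]

/-- Resolves the overlap u v w. Up to sign this is the cyclic sum of the commutators [u, rel(v, w)]:
the quadratic parts of the relations cancel by the Jacobi identity of an associative algebra, and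
the κ-parts by `jacobi_monoidIncl`. -/
theorem rel_braid (u v w : V) :
    rel κ u v * vec k M w + vec k M v * rel κ u w + rel κ v w * vec k M u
      - vec k M u * rel κ v w - rel κ u w * vec k M v - vec k M w * rel κ u v = 0 := by
  have hs : monoidIncl k M V (κ w u) = -monoidIncl k M V (κ u w) := by
    have h := hκ.alt (u + w)
    simp only [map_add, LinearMap.add_apply, hκ.alt, zero_add, add_zero] at h
    rw [← map_neg, eq_neg_of_add_eq_zero_left h]
  have h := jacobi_monoidIncl hκ u v w
  rw [hs] at h
  simp only [rel_apply]
  rw [← h]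
  noncomm_ring

end TensorSkew

end PBW

end SkewGroupDeformation

end

/-! ### The diamond lemma: rewriting words to sorted form, and confluence -/

noncomputable section

namespace SkewGroupDeformation

open Polynomial

/-! ### Inversions of words -/

section Words

variable {d : ℕ}

/-- A statistic on words which decreases when two neighbouring letters are sorted. -/
def wordWeight : List (Fin d) → ℕ
  | [] => 0
  | i :: w => (w.length + 1) * i + wordWeight w

/-- A letter counts once more than the number of letters after it. Moving the larger letter one
place to the right therefore lowers the weight by i − j. -/
theorem wordWeight_swap (p q : List (Fin d)) {i j : Fin d} (h : j < i) :
    wordWeight (p ++ j :: i :: q) < wordWeight (p ++ i :: j :: q) := by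
  induction p with
  | nil =>
    have h' : (j : ℕ) < i := h
    simp only [List.nil_append, wordWeight, List.length_cons]
    nlinarith
  | cons a p ih => simpa [wordWeight] using ih

theorem length_swap (p q : List (Fin d)) (i j : Fin d) :
    (p ++ j :: i :: q).length = (p ++ i :: j :: q).length := by simp

/-- A word, decomposed at two neighbouring letters which are in the wrong order. -/
structure Descent (w : List (Fin d)) where
  left : List (Fin d)
  fst : Fin d
  snd : Fin d
  right : List (Fin d)
  eq : w = left ++ fst :: snd :: right
  lt : snd < fst

theorem sort_eq_of_isEmpty_descent {w : List (Fin d)} (h : IsEmpty (Descent w)) :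
    (w : Multiset (Fin d)).sort = w := by
  have h1 : w.IsChain (· ≤ ·) := by
    rw [List.isChain_iff_forall_rel_of_append_cons_cons]
    intro i j p q hw
    by_contra hc
    exact h.false ⟨p, i, j, q, hw, not_le.1 hc⟩
  rw [Multiset.coe_sort]
  exact List.mergeSort_eq_self _ (List.isChain_iff_pairwise.1 h1)

end Words

section PBW

variable {k : Type*} {M : Type*} {V : Type*} [Field k] [Monoid M] [AddCommGroup V] [Module k V]
  [DistribMulAction M V] [SMulCommClass M k V] (κ : V →ₗ[k] V →ₗ[k] MonoidAlgebra k M)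
  {d : ℕ} (b : Module.Basis (Fin d) k V)

namespace TensorSkew

/-! ### The span of the words of a given length -/

theorem word_append (p q : List (Fin d)) (g : M) :
    word b (p ++ q) g = word b p (1 : M) * word b q g := by
  simp [word, mul_assoc]

theorem word_cons (i : Fin d) (q : List (Fin d)) (g : M) :
    word b (i :: q) g = vec k M (b i) * word b q g := by
  simp [word, mul_assoc]

theorem word_mem_deg (w : List (Fin d)) (g : M) : word b w g ∈ deg k M V w.length :=
  Submodule.subset_span ⟨w.map b, g, by simp, by simp [word, Function.comp_def]⟩

theorem prod_vec_mem_span_word (l : List V) (g : M) :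
    (l.map (vec k M)).prod * grp k V g ∈
      Submodule.span k {x | ∃ (w : List (Fin d)) (h : M), w.length = l.length ∧ x = word b w h} := by
  induction l with
  | nil => exact Submodule.subset_span ⟨[], g, rfl, by simp [word]⟩
  | cons v l ih =>
    rw [List.map_cons, List.prod_cons, mul_assoc]
    generalize (l.map (vec k M)).prod * grp k V g = y at ih
    induction ih using Submodule.span_induction with
    | mem x hx =>
      obtain ⟨w, h, hw, rfl⟩ := hx
      rw [← b.sum_repr v, map_sum, Finset.sum_mul]
      refine Submodule.sum_mem _ fun i _ => ?_
      rw [map_smul, smul_mul_assoc]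
      exact Submodule.smul_mem _ _
        (Submodule.subset_span ⟨i :: w, h, by simp [hw], by rw [word_cons]⟩)
    | zero => simp
    | add x y _ _ hx hy => rw [mul_add]; exact Submodule.add_mem _ hx hy
    | smul c x _ hx => rw [mul_smul_comm]; exact Submodule.smul_mem _ _ hx

theorem deg_eq_span_word (n : ℕ) : deg k M V n =
    Submodule.span k {x | ∃ (w : List (Fin d)) (h : M), w.length = n ∧ x = word b w h} := by
  apply le_antisymm
  · rw [deg, Submodule.span_le]
    rintro _ ⟨l, g, rfl, rfl⟩
    exact prod_vec_mem_span_word b l g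
  · rw [Submodule.span_le]
    rintro _ ⟨w, g, rfl, rfl⟩
    exact word_mem_deg b w g

theorem length_of_mem_support {n : ℕ} {x : TensorSkew k M V} (hx : x ∈ deg k M V n)
    {y : List (Fin d) × M} (hy : y ∈ ((basis b).repr x).support) : y.1.length = n := by
  have h : {x | ∃ (w : List (Fin d)) (h : M), w.length = n ∧ x = word b w h} =
      basis b '' {y : List (Fin d) × M | y.1.length = n} := by
    ext x
    constructor
    · rintro ⟨w, h, hw, rfl⟩
      exact ⟨(w, h), hw, basis_apply b w h⟩
    · rintro ⟨⟨w, h⟩, hw, rfl⟩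
      exact ⟨w, h, hw, basis_apply b w h⟩
  rw [deg_eq_span_word b, h, Module.Basis.mem_span_image] at hx
  exact hx hy

theorem top_induction {p : TensorSkew k M V → Prop} (x : TensorSkew k M V)
    (word : ∀ w g, p (word b w g)) (zero : p 0) (add : ∀ x y, p x → p y → p (x + y))
    (smul : ∀ (c : k) x, p x → p (c • x)) : p x := by
  have hx : x ∈ Submodule.span k (Set.range (basis (M := M) b)) := by
    rw [(basis b).span_eq]; trivial
  induction hx using Submodule.span_induction with
  | mem x hx => obtain ⟨⟨w, g⟩, rfl⟩ := hx; rw [basis_apply]; exact word w g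
  | zero => exact zero
  | add x y _ _ hx hy => exact add x y hx hy
  | smul c x _ hx => exact smul c x hx

/-! ### Normal forms -/

open Classical in
/-- The normal form of a word `b_{i₁} ⋯ b_{iₙ} g` modulo the relations `v w - w v = κ(v, w)`: a
linear combination of sorted words. -/
def wordNormalForm (w : List (Fin d)) (g : M) : (Multiset (Fin d) × M) →₀ k :=
  -- An arbitrary descent is rewritten. Independence of this choice is the content of the confluence
  -- argument.
  if h : Nonempty (Descent w) then
    wordNormalForm (h.some.left ++ h.some.snd :: h.some.fst :: h.some.right) g +
    ((basis b).repr (word b h.some.left 1 * monoidIncl k M V (κ (b h.some.fst) (b h.some.snd)) *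
      word b h.some.right g)).sum fun x r =>
        -- The guard only serves termination: the product has degree two less than the length of w,
        -- so every word in its expansion passes. `normalForm_of_mem_deg` removes it.
        if _hx : x.1.length < w.length then r • wordNormalForm x.1 x.2 else 0
  else Finsupp.single ((w : Multiset (Fin d)), g) 1
-- A swap keeps the length and lowers the weight; the κ-term lowers the length.
termination_by (w.length, wordWeight w)
decreasing_by
  · have h1 := h.some.eq
    have h2 := wordWeight_swap h.some.left h.some.right h.some.lt
    rw [← h1] at h2
    have h3 := length_swap h.some.left h.some.right h.some.fst h.some.snd
    rw [← h1] at h3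
    rw [h3]
    exact Prod.Lex.right _ h2
  · exact Prod.Lex.left _ _ _hx

/-- The normal form of an element of `T(V) # M`, as a linear map. -/
def normalForm : TensorSkew k M V →ₗ[k] (Multiset (Fin d) × M) →₀ k :=
  (basis b).constr k fun x => wordNormalForm κ b x.1 x.2

theorem normalForm_word (w : List (Fin d)) (g : M) :
    normalForm κ b (word b w g) = wordNormalForm κ b w g := by
  rw [normalForm, ← basis_apply, Module.Basis.constr_basis]

theorem normalForm_of_mem_deg {m n : ℕ} (hmn : m < n) {x : TensorSkew k M V}
    (hx : x ∈ deg k M V m) :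
    (((basis b).repr x).sum fun y r =>
      if _hy : y.1.length < n then r • wordNormalForm κ b y.1 y.2 else 0) = normalForm κ b x := by
  rw [normalForm, Module.Basis.constr_apply]
  refine Finsupp.sum_congr fun y hy => ?_
  rw [dif_pos ((length_of_mem_support b hx hy).trans_lt hmn)]

theorem mul_monoidIncl_mul_mem_deg {m n : ℕ} {x y : TensorSkew k M V} (hx : x ∈ deg k M V m)
    (hy : y ∈ deg k M V n) (z : MonoidAlgebra k M) :
    x * monoidIncl k M V z * y ∈ deg k M V (m + n) := by
  simpa using mul_mem_deg (mul_mem_deg hx (monoidIncl_mem_deg z)) hy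

theorem normalForm_of_isEmpty {w : List (Fin d)} (h : IsEmpty (Descent w)) (g : M) :
    normalForm κ b (word b w g) = Finsupp.single ((w : Multiset (Fin d)), g) 1 := by
  rw [normalForm_word, wordNormalForm, dif_neg (not_nonempty_iff.2 h)]

theorem exists_normalForm_eq {w : List (Fin d)} (h : Nonempty (Descent w)) (g : M) :
    ∃ D : Descent w, normalForm κ b (word b w g) =
      normalForm κ b (word b (D.left ++ D.snd :: D.fst :: D.right) g) +
      normalForm κ b (word b D.left 1 * monoidIncl k M V (κ (b D.fst) (b D.snd)) *
        word b D.right g) := by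
  refine ⟨h.some, ?_⟩
  have hlen := congrArg List.length h.some.eq
  rw [normalForm_word, wordNormalForm, dif_pos h, ← normalForm_word,
    normalForm_of_mem_deg κ b _ (mul_monoidIncl_mul_mem_deg (word_mem_deg b h.some.left 1)
      (word_mem_deg b h.some.right g) _)]
  rw [hlen]
  simp

theorem word_swap_rel (p q : List (Fin d)) (i j : Fin d) (g : M) :
    word b p 1 * rel κ (b i) (b j) * word b q g = word b (p ++ i :: j :: q) g
      - word b (p ++ j :: i :: q) g
      - word b p 1 * monoidIncl k M V (κ (b i) (b j)) * word b q g := by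
  rw [word_append, word_append, word_cons, word_cons, word_cons, word_cons, rel_apply]
  noncomm_ring

/-- By construction the normal form kills the relation at the one descent chosen in its definition.
Confluence transfers this to every other descent. -/
theorem exists_normalForm_rel_eq_zero {w : List (Fin d)} (h : Nonempty (Descent w)) (g : M) :
    ∃ D : Descent w, normalForm κ b
      (word b D.left 1 * rel κ (b D.fst) (b D.snd) * word b D.right g) = 0 := by
  obtain ⟨D, hD⟩ := exists_normalForm_eq κ b h g
  refine ⟨D, ?_⟩
  rw [word_swap_rel, map_sub, map_sub, ← D.eq, hD]
  simp

/-! ### Confluence -/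

section Confluence

variable {κ} (hκ : IsPBWForm κ)
include hκ

/-- Bilinear extension of `H` from basis words to arbitrary factors of bounded degree. The element
of M that ends a word on the left is first moved across the relation by `grp_mul_rel`. -/
theorem normalForm_mul_rel_mul {n : ℕ}
    (H : ∀ (p : List (Fin d)) (i j : Fin d) (q : List (Fin d)) (g : M), p.length + q.length < n →
      normalForm κ b (word b p 1 * rel κ (b i) (b j) * word b q g) = 0)
    {m m' : ℕ} (hm : m + m' < n) {x y : TensorSkew k M V} (hx : x ∈ deg k M V m)
    (hy : y ∈ deg k M V m') (u v : V) : normalForm κ b (x * rel κ u v * y) = 0 := by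
  have h1 : ∀ p q g, p.length + q.length < n → ∀ u v : V,
      normalForm κ b (word b p 1 * rel κ u v * word b q g) = 0 := by
    intro p q g hpq u v
    rw [← b.sum_repr u, ← b.sum_repr v]
    simp only [map_sum, map_smul, LinearMap.sum_apply, LinearMap.smul_apply, Finset.mul_sum,
      Finset.sum_mul, mul_smul_comm, smul_mul_assoc]
    simp only [H _ _ _ _ _ hpq, smul_zero, Finset.sum_const_zero]
  have h2 : ∀ p : List (Fin d), p.length = m → ∀ z ∈ deg k M V m', ∀ u v : V,
      normalForm κ b (word b p 1 * rel κ u v * z) = 0 := by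
    intro p hp z hz u v
    rw [deg_eq_span_word b] at hz
    induction hz using Submodule.span_induction with
    | mem z hz => obtain ⟨w, g, hw, rfl⟩ := hz; exact h1 _ _ _ (by omega) _ _
    | zero => simp
    | add x y _ _ hx hy => rw [mul_add, map_add, hx, hy, add_zero]
    | smul c x _ hx => rw [mul_smul_comm, map_smul, hx, smul_zero]
  rw [deg_eq_span_word b] at hx
  induction hx using Submodule.span_induction with
  | mem x hx =>
    obtain ⟨p, g, hp, rfl⟩ := hx
    have : word b p g * rel κ u v * y = word b p 1 * rel κ (g • u) (g • v) * (grp k V g * y) := by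
      rw [word, word, map_one, mul_one, mul_assoc _ (grp k V g), grp_mul_rel hκ]
      simp only [mul_assoc]
    rw [this]
    exact h2 p hp _ (by simpa using mul_mem_deg (grp_mem_deg g) hy) _ _
  | zero => simp
  | add x y _ _ hx hy => rw [add_mul, add_mul, map_add, hx, hy, add_zero]
  | smul c x _ hx => rw [smul_mul_assoc, smul_mul_assoc, map_smul, hx, smul_zero]

section Step

variable {n : ℕ} {g : M}
  (H : ∀ (p : List (Fin d)) (i j : Fin d) (q : List (Fin d)) (g : M), p.length + q.length < n →
    normalForm κ b (word b p 1 * rel κ (b i) (b j) * word b q g) = 0)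
  {N : ℕ} (H' : ∀ (p : List (Fin d)) (i j : Fin d) (q : List (Fin d)), p.length + q.length = n →
    j < i → wordWeight (p ++ i :: j :: q) < N →
      normalForm κ b (word b p 1 * rel κ (b i) (b j) * word b q g) = 0)
include H H'

/-- Two descents with no common letter can be rewritten in either order. The difference of the two
relations consists of relations in words with the other descent already swapped (smaller weight,
`H'`) and of relations beside a κ-term (lower degree, `H`). -/
theorem normalForm_rel_far (p s q : List (Fin d)) {i j i' j' : Fin d} (hij : j < i) (hij' : j' < i')
    (hn : p.length + (s ++ i' :: j' :: q).length = n)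
    (hN : wordWeight (p ++ i :: j :: (s ++ i' :: j' :: q)) = N) :
    normalForm κ b (word b p 1 * rel κ (b i) (b j) * word b (s ++ i' :: j' :: q) g) =
    normalForm κ b (word b (p ++ i :: j :: s) 1 * rel κ (b i') (b j') * word b q g) := by
  have hN1 : wordWeight ((p ++ j :: i :: s) ++ i' :: j' :: q) < N := by
    rw [← hN]
    simpa using wordWeight_swap p (s ++ i' :: j' :: q) hij
  have hN2 : wordWeight (p ++ i :: j :: (s ++ j' :: i' :: q)) < N := by
    rw [← hN]
    simpa using wordWeight_swap (p ++ i :: j :: s) q hij'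
  simp only [List.length_append, List.length_cons] at hn
  have e1 := H' _ _ _ _ (by simp; omega) hij' hN1
  have e2 := H' _ _ _ _ (by simp; omega) hij hN2
  have e3 := normalForm_mul_rel_mul b hκ H (by omega) (word_mem_deg b p (1 : M))
    (mul_monoidIncl_mul_mem_deg (word_mem_deg b s (1 : M)) (word_mem_deg b q g)
      (κ (b i') (b j'))) (b i) (b j)
  have e4 := normalForm_mul_rel_mul b hκ H (by omega)
    (mul_monoidIncl_mul_mem_deg (word_mem_deg b p (1 : M)) (word_mem_deg b s (1 : M))
      (κ (b i) (b j))) (word_mem_deg b q g) (b i') (b j')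
  rw [← sub_eq_zero, ← map_sub]
  rw [← map_zero (normalForm κ b)] at e1 e2 e3 e4
  have key : word b p 1 * rel κ (b i) (b j) * word b (s ++ i' :: j' :: q) g -
      word b (p ++ i :: j :: s) 1 * rel κ (b i') (b j') * word b q g =
      word b p 1 * rel κ (b i) (b j) * word b (s ++ j' :: i' :: q) g +
      word b p 1 * rel κ (b i) (b j) *
        (word b s 1 * monoidIncl k M V (κ (b i') (b j')) * word b q g) -
      word b (p ++ j :: i :: s) 1 * rel κ (b i') (b j') * word b q g -
      word b p 1 * monoidIncl k M V (κ (b i) (b j)) * word b s 1 * rel κ (b i') (b j')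
        * word b q g := by
    simp only [word_append, word_cons]
    generalize word b p (1 : M) = P
    generalize word b s (1 : M) = S
    generalize word b q g = Q
    simp only [rel_apply]
    noncomm_ring
  rw [key, map_sub, map_sub, map_add, e1, e2, e3, e4]
  simp

omit H in
-- The only genuine ambiguity: overlapping descents i > j > l. `rel_braid` writes the difference in
-- terms of four relations, each sitting at a descent of a partly sorted word of smaller weight.
theorem normalForm_rel_adjacent (p q : List (Fin d)) {i j l : Fin d} (hij : j < i) (hjl : l < j)
    (hn : p.length + (l :: q).length = n) (hN : wordWeight (p ++ i :: j :: l :: q) = N) :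
    normalForm κ b (word b p 1 * rel κ (b i) (b j) * word b (l :: q) g) =
    normalForm κ b (word b (p ++ [i]) 1 * rel κ (b j) (b l) * word b q g) := by
  have w1 : wordWeight (p ++ j :: i :: l :: q) < N := hN ▸ wordWeight_swap p (l :: q) hij
  have w2 : wordWeight (p ++ i :: l :: j :: q) < N := by
    rw [← hN]; simpa using wordWeight_swap (p ++ [i]) q hjl
  have w3 : wordWeight (p ++ j :: l :: i :: q) < N := by
    refine lt_trans ?_ w1
    simpa using wordWeight_swap (p ++ [j]) q (hjl.trans hij)
  have w4 : wordWeight (p ++ l :: i :: j :: q) < N :=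
    lt_trans (wordWeight_swap p (j :: q) (hjl.trans hij)) w2
  simp only [List.length_cons] at hn
  have e1 := H' (p ++ [j]) i l q (by simp; omega) (hjl.trans hij) (by simpa using w1)
  have e2 := H' p j l (i :: q) (by simp; omega) hjl w3
  have e3 := H' p i l (j :: q) (by simp; omega) (hjl.trans hij) w2
  have e4 := H' (p ++ [l]) i j q (by simp; omega) hij (by simpa using w4)
  have key : word b p 1 * rel κ (b i) (b j) * word b (l :: q) g -
      word b (p ++ [i]) 1 * rel κ (b j) (b l) * word b q g =
      word b (p ++ [l]) 1 * rel κ (b i) (b j) * word b q g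
      + word b p 1 * rel κ (b i) (b l) * word b (j :: q) g
      - word b p 1 * rel κ (b j) (b l) * word b (i :: q) g
      - word b (p ++ [j]) 1 * rel κ (b i) (b l) * word b q g := by
    have hb := congrArg (fun x => word b p (1 : M) * x * word b q g)
      (rel_braid hκ (b i) (b j) (b l))
    have h1 : ∀ a : Fin d, word b [a] (1 : M) = vec k M (b a) := fun a => by simp [word]
    simp only [mul_zero, zero_mul] at hb
    simp only [word_append, word_cons, h1]
    rw [← sub_eq_zero, ← hb]
    noncomm_ring
  rw [← sub_eq_zero, ← map_sub, key, map_sub, map_sub, map_add, e1, e2, e3, e4]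
  simp

theorem normalForm_rel_eq_of_descents (p p' q q' : List (Fin d)) {i j i' j' : Fin d} (hij : j < i)
    (hij' : j' < i') (hn : p.length + q.length = n) (hN : wordWeight (p ++ i :: j :: q) = N)
    (h : p ++ i :: j :: q = p' ++ i' :: j' :: q') :
    normalForm κ b (word b p 1 * rel κ (b i) (b j) * word b q g) =
    normalForm κ b (word b p' 1 * rel κ (b i') (b j') * word b q' g) := by
  -- Here the second descent starts |s| places to the right of the first: they coincide for |s| = 0,
  -- overlap in one letter for |s| = 1, and are disjoint for |s| ≥ 2.
  have main : ∀ (p s q q' : List (Fin d)) {i j i' j' : Fin d}, j < i → j' < i' →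
      p.length + q.length = n → wordWeight (p ++ i :: j :: q) = N →
      i :: j :: q = s ++ i' :: j' :: q' →
      normalForm κ b (word b p 1 * rel κ (b i) (b j) * word b q g) =
      normalForm κ b (word b (p ++ s) 1 * rel κ (b i') (b j') * word b q' g) := by
    intro p s q q' i j i' j' hij hij' hn hN h
    match s with
    | [] =>
      simp only [List.nil_append, List.cons.injEq] at h
      obtain ⟨rfl, rfl, rfl⟩ := h
      simp
    | [a] =>
      simp only [List.cons_append, List.nil_append, List.cons.injEq] at h
      obtain ⟨rfl, rfl, rfl⟩ := h
      exact normalForm_rel_adjacent b hκ H' p q' hij hij' hn hN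
    | a :: a' :: s =>
      simp only [List.cons_append, List.cons.injEq] at h
      obtain ⟨rfl, rfl, rfl⟩ := h
      exact normalForm_rel_far b hκ H H' p s q' hij hij' hn hN
  rcases List.append_eq_append_iff.1 h with ⟨s, hs, hs'⟩ | ⟨s, hs, hs'⟩
  · rw [hs]
    exact main p s q q' hij hij' hn hN hs'
  · rw [hs]
    have hlen := congrArg List.length h
    simp only [List.length_append, List.length_cons] at hlen
    exact (main p' s q' q hij' hij (by omega) (by rw [← h, hN]) hs').symm

end Step

/-- Induction on the length of the context, and for fixed length on the weight. All descents of a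
word give the same value, and at the chosen one this value is zero. Pairs i ≤ j reduce to descents
because the relation is alternating. -/
theorem normalForm_rel_basis (p : List (Fin d)) (i j : Fin d) (q : List (Fin d)) (g : M) :
    normalForm κ b (word b p 1 * rel κ (b i) (b j) * word b q g) = 0 := by
  induction hn : p.length + q.length using Nat.strong_induction_on
    generalizing p i j q g with | _ n H
  have H1 : ∀ (p : List (Fin d)) (i j : Fin d) (q : List (Fin d)) (g : M),
      p.length + q.length < n → normalForm κ b (word b p 1 * rel κ (b i) (b j) * word b q g) = 0 :=
    fun p i j q g h => H _ h p i j q g rfl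
  have H2 : ∀ N, ∀ (p : List (Fin d)) (i j : Fin d) (q : List (Fin d)), p.length + q.length = n →
      j < i → wordWeight (p ++ i :: j :: q) = N →
      normalForm κ b (word b p 1 * rel κ (b i) (b j) * word b q g) = 0 := by
    intro N
    induction N using Nat.strong_induction_on with | _ N ih
    intro p i j q hn hij hN
    obtain ⟨D, hD⟩ := exists_normalForm_rel_eq_zero κ b ⟨(⟨p, i, j, q, rfl, hij⟩ : Descent _)⟩ g
    rw [← hD]
    exact normalForm_rel_eq_of_descents b hκ H1 (fun p i j q h1 h2 h3 => ih _ h3 p i j q h1 h2 rfl)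
      p D.left q D.right hij D.lt hn hN D.eq
  rcases lt_trichotomy i j with h | rfl | h
  · rw [rel_swap hκ, mul_neg, neg_mul, map_neg, H2 _ p j i q hn h rfl, neg_zero]
  · simp [rel_self hκ]
  · exact H2 _ p i j q hn h rfl

theorem normalForm_rel (x y : TensorSkew k M V) (u v : V) :
    normalForm κ b (x * rel κ u v * y) = 0 := by
  have h1 : ∀ p h q g, normalForm κ b (word b p h * rel κ u v * word b q g) = 0 :=
    fun p h q g => normalForm_mul_rel_mul b hκ (n := p.length + q.length + 1)
      (fun p i j q g _ => normalForm_rel_basis b hκ p i j q g)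
      (m := p.length) (m' := q.length) (by omega) (word_mem_deg b p h) (word_mem_deg b q g) u v
  refine top_induction (p := fun x => normalForm κ b (x * rel κ u v * y) = 0) b x (fun p h => ?_) (by simp)
    (fun x y hx hy => by rw [add_mul, add_mul, map_add, hx, hy, add_zero])
    (fun c x hx => by rw [smul_mul_assoc, smul_mul_assoc, map_smul, hx, smul_zero])
  exact top_induction (p := fun y => normalForm κ b (word b p h * rel κ u v * y) = 0) b y (fun q g => h1 p h q g) (by simp)
    (fun x y hx hy => by rw [mul_add, map_add, hx, hy, add_zero])
    (fun c x hx => by rw [mul_smul_comm, map_smul, hx, smul_zero])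

end Confluence

end TensorSkew

end PBW

end SkewGroupDeformation

end

noncomputable section

namespace SkewGroupDeformation

open Polynomial

section PBW

variable {k : Type*} {M : Type*} {V : Type*} [Field k] [Monoid M] [AddCommGroup V] [Module k V]
  [DistribMulAction M V] [SMulCommClass M k V] (κ : V →ₗ[k] V →ₗ[k] MonoidAlgebra k M)

/-! ### The quotient of `T(V) # M` by the relations `v w - w v = κ(v, w)` -/

/-- The two-sided ideal of `T(V) # M` generated by the elements `v w - w v - κ(v, w)`. -/
def relIdeal : Ideal (TensorSkew k M V) :=
  Ideal.span {x | ∃ u v y, x = TensorSkew.rel κ u v * y}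

/-- The generating set of this left ideal is already closed under multiplication on the right. -/
instance : (relIdeal κ).IsTwoSided where
  mul_mem_of_left {x} z hx := by
    induction hx using Submodule.span_induction with
    | mem x hx =>
      obtain ⟨u, v, y, rfl⟩ := hx
      exact Ideal.subset_span ⟨u, v, y * z, mul_assoc _ _ _⟩
    | zero => simp
    | add x y _ _ hx hy => rw [add_mul]; exact add_mem hx hy
    | smul c x _ hx => rw [smul_eq_mul, mul_assoc]; exact Ideal.mul_mem_left _ _ hx

/-- The quotient of `T(V) # M` by the relations `v w - w v = κ(v, w)`. -/
def SkewQuotient : Type _ := TensorSkew k M V ⧸ relIdeal κ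

namespace SkewQuotient

instance : Ring (SkewQuotient κ) := inferInstanceAs (Ring (TensorSkew k M V ⧸ relIdeal κ))

instance : Algebra k (SkewQuotient κ) :=
  inferInstanceAs (Algebra k (TensorSkew k M V ⧸ relIdeal κ))

/-- The projection from `T(V) # M`. -/
def mk : TensorSkew k M V →ₐ[k] SkewQuotient κ := Ideal.Quotient.mkₐ k (relIdeal κ)

theorem mk_surjective : Function.Surjective (mk κ) := Ideal.Quotient.mkₐ_surjective k _

theorem mk_eq_zero {x : TensorSkew k M V} : mk κ x = 0 ↔ x ∈ relIdeal κ :=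
  Ideal.Quotient.eq_zero_iff_mem

theorem mk_rel (u v : V) : mk κ (TensorSkew.rel κ u v) = 0 :=
  (mk_eq_zero κ).2 (Ideal.subset_span ⟨u, v, 1, by simp⟩)

/-- The image of a vector. -/
def vec : V →ₗ[k] SkewQuotient κ := (mk κ).toLinearMap ∘ₗ TensorSkew.vec k M

/-- The image of an element of `M`. -/
def grp : M →* SkewQuotient κ := (mk κ : TensorSkew k M V →* SkewQuotient κ).comp
  (TensorSkew.grp k V)

@[simp] theorem mk_vec (v : V) : mk κ (TensorSkew.vec k M v) = vec κ v := rfl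

@[simp] theorem mk_grp (g : M) : mk κ (TensorSkew.grp k V g) = grp κ g := rfl

@[simp] theorem mk_monoidIncl (x : MonoidAlgebra k M) :
    mk κ (TensorSkew.monoidIncl k M V x) = MonoidAlgebra.lift k _ M (grp κ) x := by
  change ((mk κ).comp (TensorSkew.monoidIncl k M V)) x = _
  congr 1
  ext g
  simp [TensorSkew.monoidIncl]

theorem grp_mul_vec (g : M) (v : V) : grp κ g * vec κ v = vec κ (g • v) * grp κ g := by
  simp only [← mk_vec, ← mk_grp, ← map_mul, TensorSkew.grp_mul_vec]

theorem vec_mul_vec_sub (v w : V) :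
    vec κ v * vec κ w - vec κ w * vec κ v = MonoidAlgebra.lift k _ M (grp κ) (κ v w) := by
  rw [← sub_eq_zero, ← mk_rel κ v w, TensorSkew.rel_apply]
  simp

section Lift

variable {κ} {E : Type*} [Ring E] [Algebra k E] (φ : V →ₗ[k] E) (ψ : M →* E)
  (h : ∀ g v, ψ g * φ v = φ (g • v) * ψ g)
  (hrel : ∀ v w, φ v * φ w - φ w * φ v = MonoidAlgebra.lift k E M ψ (κ v w))

/-- The universal property. -/
def lift : SkewQuotient κ →ₐ[k] E :=
  Ideal.Quotient.liftₐ (relIdeal κ) (TensorSkew.lift φ ψ h) (by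
    intro x hx
    induction hx using Submodule.span_induction with
    | mem x hx =>
      obtain ⟨u, v, y, rfl⟩ := hx
      rw [map_mul, TensorSkew.rel_apply]
      simp [hrel]
    | zero => simp
    | add x y _ _ hx hy => rw [map_add, hx, hy, add_zero]
    | smul c x _ hx => rw [smul_eq_mul, map_mul, hx, mul_zero])

theorem lift_mk (x : TensorSkew k M V) : lift φ ψ h hrel (mk κ x) = TensorSkew.lift φ ψ h x := rfl

@[simp] theorem lift_vec (v : V) : lift φ ψ h hrel (vec κ v) = φ v := by
  rw [← mk_vec, lift_mk, TensorSkew.lift_vec]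

@[simp] theorem lift_grp (g : M) : lift φ ψ h hrel (grp κ g) = ψ g := by
  rw [← mk_grp, lift_mk, TensorSkew.lift_grp]

end Lift

variable {κ}

theorem hom_ext {E : Type*} [Ring E] [Algebra k E] {f f' : SkewQuotient κ →ₐ[k] E}
    (hv : ∀ v, f (vec κ v) = f' (vec κ v)) (hg : ∀ g, f (grp κ g) = f' (grp κ g)) : f = f' := by
  have h : f.comp (mk κ) = f'.comp (mk κ) := TensorSkew.hom_ext hv hg
  ext x
  obtain ⟨x, rfl⟩ := mk_surjective κ x
  exact DFunLike.congr_fun h x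

/-! ### The Poincaré-Birkhoff-Witt basis -/

variable {d : ℕ} (b : Module.Basis (Fin d) k V)

/-- The element `b_{i₁} ⋯ b_{iₙ} g` of the quotient. -/
def word (w : List (Fin d)) (g : M) : SkewQuotient κ :=
  (w.map fun i => vec κ (b i)).prod * grp κ g

theorem mk_word (w : List (Fin d)) (g : M) : mk κ (TensorSkew.word b w g) = word b w g := by
  simp [TensorSkew.word, word, map_list_prod, Function.comp_def]

theorem word_swap {w : List (Fin d)} (D : Descent w) (g : M) :
    word (κ := κ) b w g = word b (D.left ++ D.snd :: D.fst :: D.right) g +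
      mk κ (TensorSkew.word b D.left 1 * TensorSkew.monoidIncl k M V (κ (b D.fst) (b D.snd)) *
        TensorSkew.word b D.right g) := by
  have h := congrArg (mk κ) (TensorSkew.word_swap_rel κ b D.left D.right D.fst D.snd g)
  rw [map_mul, map_mul, mk_rel, map_sub, map_sub, mk_word, mk_word, ← D.eq] at h
  rw [mul_zero, zero_mul] at h
  rw [eq_comm, sub_sub, sub_eq_zero] at h
  rw [← mk_word, ← mk_word, h]

/-- An induction principle for words: to prove a statement for all words it suffices to prove it
for sorted words, and for a word in terms of one with two letters swapped and of shorter ones. -/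
theorem word_induction {p : List (Fin d) → Prop}
    (sorted : ∀ w, IsEmpty (Descent w) → p w)
    (step : ∀ w, Nonempty (Descent w) → (∀ w', w'.length < w.length → p w') →
      (∀ w', w'.length = w.length → wordWeight w' < wordWeight w → p w') → p w)
    (w : List (Fin d)) : p w := by
  induction hn : w.length using Nat.strong_induction_on generalizing w with | _ n ih
  induction hN : wordWeight w using Nat.strong_induction_on generalizing w with | _ N ih'
  rcases isEmpty_or_nonempty (Descent w) with h | h
  · exact sorted w h
  · exact step w h (fun w' hw' => ih _ (hn ▸ hw') w' rfl)
      (fun w' h1 h2 => ih' _ (hN ▸ h2) w' (h1.trans hn) rfl)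

variable (κ) in
/-- The linear map which sends sorted words to their classes. -/
def ofNormalForm : ((Multiset (Fin d) × M) →₀ k) →ₗ[k] SkewQuotient κ :=
  Finsupp.linearCombination k fun x => word b x.1.sort x.2

theorem ofNormalForm_single (m : Multiset (Fin d)) (g : M) :
    ofNormalForm κ b (Finsupp.single (m, g) 1) = word b m.sort g := by
  simp [ofNormalForm]

theorem ofNormalForm_eq_of_mem_deg {n : ℕ} {x : TensorSkew k M V}
    (H : ∀ w g, w.length < n →
      ofNormalForm κ b (TensorSkew.normalForm κ b (TensorSkew.word b w g)) = word b w g)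
    {m : ℕ} (hm : m < n) (hx : x ∈ TensorSkew.deg k M V m) :
    ofNormalForm κ b (TensorSkew.normalForm κ b x) = mk κ x := by
  rw [TensorSkew.deg_eq_span_word b] at hx
  induction hx using Submodule.span_induction with
  | mem x hx => obtain ⟨w, g, hw, rfl⟩ := hx; rw [H _ _ (hw ▸ hm), mk_word]
  | zero => simp
  | add x y _ _ hx hy => rw [map_add, map_add, map_add, hx, hy]
  | smul c x _ hx => rw [map_smul, map_smul, map_smul, hx]

theorem descent_length {w : List (Fin d)} (D : Descent w) :
    D.left.length + D.right.length + 2 = w.length := by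
  have := congrArg List.length D.eq
  simp only [List.length_append, List.length_cons] at this
  omega

theorem descent_weight {w : List (Fin d)} (D : Descent w) :
    wordWeight (D.left ++ D.snd :: D.fst :: D.right) < wordWeight w := by
  have h := wordWeight_swap D.left D.right D.lt
  rwa [← D.eq] at h

theorem descent_length_swap {w : List (Fin d)} (D : Descent w) :
    (D.left ++ D.snd :: D.fst :: D.right).length = w.length := by
  rw [length_swap, ← D.eq]

/-- Each rewriting step is an identity in the quotient. This is the spanning half of the PBW
theorem, which holds for every bilinear κ. -/
theorem ofNormalForm_normalForm_word (w : List (Fin d)) (g : M) :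
    ofNormalForm κ b (TensorSkew.normalForm κ b (TensorSkew.word b w g)) = word b w g := by
  induction w using word_induction generalizing g with
  | sorted w hw =>
    rw [TensorSkew.normalForm_of_isEmpty κ b hw, ofNormalForm_single,
      sort_eq_of_isEmpty_descent hw]
  | step w hw ih ih' =>
    obtain ⟨D, hD⟩ := TensorSkew.exists_normalForm_eq κ b hw g
    rw [hD, map_add, ih' _ (descent_length_swap D) (descent_weight D), word_swap b D,
      ofNormalForm_eq_of_mem_deg b (fun w g h => ih w h g)
        (show D.left.length + D.right.length < w.length by have := descent_length D; omega)
        (TensorSkew.mul_monoidIncl_mul_mem_deg (TensorSkew.word_mem_deg b _ _)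
          (TensorSkew.word_mem_deg b _ _) _)]

theorem ofNormalForm_normalForm (x : TensorSkew k M V) :
    ofNormalForm κ b (TensorSkew.normalForm κ b x) = mk κ x := by
  refine TensorSkew.top_induction
    (p := fun x => ofNormalForm κ b (TensorSkew.normalForm κ b x) = mk κ x) b x
    (fun w g => by rw [ofNormalForm_normalForm_word, mk_word]) (by simp)
    (fun x y hx hy => by rw [map_add, map_add, map_add, hx, hy])
    (fun c x hx => by rw [map_smul, map_smul, map_smul, hx])

theorem normalForm_sort (m : Multiset (Fin d)) (g : M) :
    TensorSkew.normalForm κ b (TensorSkew.word b m.sort g) = Finsupp.single (m, g) 1 := by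
  have h : IsEmpty (Descent m.sort) := by
    refine ⟨fun D => ?_⟩
    have h := m.pairwise_sort (· ≤ ·)
    rw [← List.isChain_iff_pairwise, List.isChain_iff_forall_rel_of_append_cons_cons] at h
    exact absurd D.lt (not_lt.2 (h D.eq))
  rw [TensorSkew.normalForm_of_isEmpty κ b h, Multiset.sort_eq]

section Basis

variable (hκ : IsPBWForm κ)
include hκ

theorem normalForm_of_mem_relIdeal {x : TensorSkew k M V} (hx : x ∈ relIdeal κ) :
    TensorSkew.normalForm κ b x = 0 := by
  -- The normal form is only k-linear while the ideal is spanned over the whole ring, so all left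
  -- multiples are treated together.
  have h : ∀ z, TensorSkew.normalForm κ b (z * x) = 0 := by
    induction hx using Submodule.span_induction with
    | mem x hx =>
      obtain ⟨u, v, y, rfl⟩ := hx
      intro z
      rw [← mul_assoc, TensorSkew.normalForm_rel b hκ]
    | zero => simp
    | add x y _ _ hx hy => intro z; rw [mul_add, map_add, hx, hy, add_zero]
    | smul c x _ hx => intro z; rw [smul_eq_mul, ← mul_assoc, hx]
  simpa using h 1

/-- Injectivity: lift a combination of sorted words to T(V) # M. Its normal form is the combination
itself, but if its class is zero then the normal form vanishes, by confluence. -/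
theorem ofNormalForm_bijective : Function.Bijective (ofNormalForm κ b (M := M)) := by
  constructor
  · rw [← LinearMap.ker_eq_bot, LinearMap.ker_eq_bot']
    intro x hx
    let y : TensorSkew k M V := x.sum fun p c => c • TensorSkew.word b p.1.sort p.2
    have hy : TensorSkew.normalForm κ b y = x := by
      simp only [y, Finsupp.sum, map_sum, map_smul, normalForm_sort]
      conv_rhs => rw [← Finsupp.sum_single x]
      simp [Finsupp.sum]
    have hy' : mk κ y = 0 := by rw [← ofNormalForm_normalForm b, hy, hx]
    rw [← hy]
    exact normalForm_of_mem_relIdeal b hκ ((mk_eq_zero κ).1 hy')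
  · intro x
    obtain ⟨x, rfl⟩ := mk_surjective κ x
    exact ⟨_, ofNormalForm_normalForm b x⟩

/-- The Poincaré-Birkhoff-Witt basis. -/
def pbwBasis : Module.Basis (Multiset (Fin d) × M) k (SkewQuotient κ) where
  repr := (LinearEquiv.ofBijective (ofNormalForm κ b) (ofNormalForm_bijective b hκ)).symm

theorem pbwBasis_apply (m : Multiset (Fin d)) (g : M) :
    pbwBasis b hκ (m, g) = word b m.sort g :=
  ofNormalForm_single b m g

end Basis

/-- The span of the sorted words of length less than `n`. -/
def lowSpan (κ : V →ₗ[k] V →ₗ[k] MonoidAlgebra k M) (n : ℕ) : Submodule k (SkewQuotient κ) :=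
  Submodule.span k {x | ∃ (m : Multiset (Fin d)) (g : M), m.card < n ∧ x = word b m.sort g}

theorem lowSpan_mono {m n : ℕ} (h : m ≤ n) : lowSpan b κ m ≤ lowSpan b κ n :=
  Submodule.span_mono fun _ ⟨s, g, hs, hx⟩ => ⟨s, g, hs.trans_le h, hx⟩

/-- Sorting a word costs only κ-terms, which are shorter. So the leading term of a word is its
commutative image. -/
theorem word_sub_mem_lowSpan (w : List (Fin d)) (g : M) :
    word b w g - word b (w : Multiset (Fin d)).sort g ∈ lowSpan b κ w.length := by
  induction w using word_induction generalizing g with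
  | sorted w hw => rw [sort_eq_of_isEmpty_descent hw]; simp
  | step w hw ih ih' =>
    obtain ⟨D⟩ := hw
    have h1 := ih' _ (descent_length_swap D) (descent_weight D) g
    have h2 : ((D.left ++ D.snd :: D.fst :: D.right : List (Fin d)) : Multiset (Fin d)) = w := by
      rw [Multiset.coe_eq_coe]
      conv_rhs => rw [D.eq]
      exact List.Perm.append_left _ (List.Perm.swap _ _ _)
    rw [h2, descent_length_swap] at h1
    rw [word_swap b D, add_sub_right_comm]
    refine add_mem h1 ?_
    have hlt : D.left.length + D.right.length < w.length := by have := descent_length D; omega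
    suffices h3 : ∀ x ∈ TensorSkew.deg k M V (D.left.length + D.right.length),
        mk κ x ∈ lowSpan b κ w.length from
      h3 _ (TensorSkew.mul_monoidIncl_mul_mem_deg (TensorSkew.word_mem_deg b _ _)
        (TensorSkew.word_mem_deg b _ _) _)
    intro x hx
    rw [TensorSkew.deg_eq_span_word b] at hx
    induction hx using Submodule.span_induction with
    | mem x hx =>
      obtain ⟨w', h, hw', rfl⟩ := hx
      rw [mk_word, ← sub_add_cancel (word b w' h) (word b (w' : Multiset (Fin d)).sort h)]
      refine add_mem (lowSpan_mono b (by omega) (ih w' (hw' ▸ hlt) h)) ?_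
      exact Submodule.subset_span ⟨_, h, by simpa [hw'] using hlt, rfl⟩
    | zero => simp
    | add x y _ _ hx hy => rw [map_add]; exact add_mem hx hy
    | smul c x _ hx => rw [map_smul]; exact Submodule.smul_mem _ _ hx

end SkewQuotient

end PBW

end SkewGroupDeformation

end

noncomputable section

namespace SkewGroupDeformation

open Polynomial

section SkewGroup

variable {k : Type*} {G : Type*} {V : Type*} [Field k] [Group G] [AddCommGroup V] [Module k V]
  [DistribMulAction G V] [SMulCommClass G k V]

/-! ### The skew group algebra: basis and grading -/

namespace Skew

variable (k G V) in
/-- The inclusion of `V` in `S(V) # G`, as a linear map. -/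
def vecHom : V →ₗ[k] Skew k G V where
  toFun := vec k G
  map_add' v w := by rw [vec, map_add, SkewMonoidAlgebra.single_add]; rfl
  map_smul' c v := by rw [vec, map_smul, ← SkewMonoidAlgebra.smul_single]; rfl

omit [DistribMulAction G V] [SMulCommClass G k V] in
@[simp] theorem vecHom_apply (v : V) : vecHom k G V v = vec k G v := rfl

variable (k V) in
/-- The inclusion of `G` in `S(V) # G`. -/
def grp : G →* Skew k G V := SkewMonoidAlgebra.of (SymmetricAlgebra k V) G

theorem grp_apply (g : G) : grp k V g = SkewMonoidAlgebra.single g 1 := rfl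

theorem groupIncl_single (g : G) : groupIncl k G V (MonoidAlgebra.single g 1) = grp k V g := by
  rw [groupIncl, MonoidAlgebra.lift_single, one_smul]; rfl

theorem smul_ι (g : G) (v : V) :
    g • SymmetricAlgebra.ι k V v = SymmetricAlgebra.ι k V (g • v) := symAct_ι k g v

theorem grp_mul_vec (g : G) (v : V) :
    grp k V g * vecHom k G V v = vecHom k G V (g • v) * grp k V g := by
  rw [vecHom_apply, vecHom_apply, vec, vec, grp_apply, SkewMonoidAlgebra.single_mul_single,
    SkewMonoidAlgebra.single_mul_single, smul_ι]
  simp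

variable (k G V) in
/-- The projection from `T(V) # G` to `S(V) # G`. -/
def ofTensor : TensorSkew k G V →ₐ[k] Skew k G V :=
  TensorSkew.lift (vecHom k G V) (grp k V) grp_mul_vec

@[simp] theorem ofTensor_vec (v : V) : ofTensor k G V (TensorSkew.vec k G v) = vec k G v :=
  TensorSkew.lift_vec _ _ _ v

@[simp] theorem ofTensor_grp (g : G) : ofTensor k G V (TensorSkew.grp k V g) = grp k V g :=
  TensorSkew.lift_grp _ _ _ g

theorem prod_vec_mul_grp (l : List V) (g : G) :
    (l.map (vec k G)).prod * grp k V g =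
      SkewMonoidAlgebra.single g (l.map (SymmetricAlgebra.ι k V)).prod := by
  induction l with
  | nil => simp [grp_apply]
  | cons v l ih =>
    rw [List.map_cons, List.prod_cons, mul_assoc, ih, vec, SkewMonoidAlgebra.single_mul_single]
    simp

theorem ofTensor_prod (l : List V) (g : G) :
    ofTensor k G V ((l.map (TensorSkew.vec k G)).prod * TensorSkew.grp k V g) =
      SkewMonoidAlgebra.single g (l.map (SymmetricAlgebra.ι k V)).prod := by
  rw [map_mul, map_list_prod, ofTensor_grp, ← prod_vec_mul_grp, List.map_map]
  congr 3
  ext v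
  simp

theorem range_ι_pow_le (n : ℕ) : (LinearMap.range (SymmetricAlgebra.ι k V)) ^ n ≤
    Submodule.span k {x | ∃ l : List V, l.length = n ∧ x = (l.map (SymmetricAlgebra.ι k V)).prod} := by
  induction n with
  | zero =>
    rw [pow_zero, Submodule.one_le]
    exact Submodule.subset_span ⟨[], rfl, rfl⟩
  | succ n ih =>
    rw [pow_succ', Submodule.mul_le]
    rintro _ ⟨v, rfl⟩ y hy
    replace hy := ih hy
    induction hy using Submodule.span_induction with
    | mem y hy =>
      obtain ⟨l, hl, rfl⟩ := hy
      exact Submodule.subset_span ⟨v :: l, by simp [hl], by simp⟩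
    | zero => simp
    | add x y _ _ hx hy => rw [mul_add]; exact add_mem hx hy
    | smul c x _ hx => rw [mul_smul_comm]; exact Submodule.smul_mem _ _ hx

theorem prod_ι_mem (l : List V) : (l.map (SymmetricAlgebra.ι k V)).prod ∈
    (LinearMap.range (SymmetricAlgebra.ι k V)) ^ l.length := by
  induction l with
  | nil => simp
  | cons v l ih =>
    rw [List.map_cons, List.prod_cons, List.length_cons, pow_succ']
    exact Submodule.mul_mem_mul ⟨v, rfl⟩ ih

/-- Reduces statements about the grading of S(V) # G, such as its multiplicativity, to words in T(V)
# G. -/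
theorem gradedPiece_eq_map (n : ℕ) :
    gradedPiece k G V n = (TensorSkew.deg k G V n).map (ofTensor k G V).toLinearMap := by
  apply le_antisymm
  · intro x hx
    have h : ∀ y ∈ (LinearMap.range (SymmetricAlgebra.ι k V)) ^ n, ∀ g : G,
        SkewMonoidAlgebra.single g y ∈
          (TensorSkew.deg k G V n).map (ofTensor k G V).toLinearMap := by
      intro y hy g
      replace hy := range_ι_pow_le n hy
      induction hy using Submodule.span_induction with
      | mem y hy =>
        obtain ⟨l, hl, rfl⟩ := hy
        exact ⟨_, Submodule.subset_span ⟨l, g, hl, rfl⟩, ofTensor_prod l g⟩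
      | zero => rw [SkewMonoidAlgebra.single_zero]; exact zero_mem _
      | add x y _ _ hx hy => rw [SkewMonoidAlgebra.single_add]; exact add_mem hx hy
      | smul c x _ hx =>
        rw [← SkewMonoidAlgebra.smul_single]; exact Submodule.smul_mem _ c hx
    rw [← SkewMonoidAlgebra.sum_single x]
    exact Submodule.sum_mem _ fun g _ => h _ (hx g) g
  · rw [Submodule.map_le_iff_le_comap, TensorSkew.deg, Submodule.span_le]
    rintro _ ⟨l, g, rfl, rfl⟩ h
    change (ofTensor k G V _).coeff h ∈ _
    classical
    rw [ofTensor_prod, SkewMonoidAlgebra.coeff_single_apply]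
    split_ifs
    · exact prod_ι_mem l
    · exact zero_mem _

theorem mul_mem_gradedPiece {m n : ℕ} {x y : Skew k G V} (hx : x ∈ gradedPiece k G V m)
    (hy : y ∈ gradedPiece k G V n) : x * y ∈ gradedPiece k G V (m + n) := by
  rw [gradedPiece_eq_map] at hx hy ⊢
  obtain ⟨x, hx, rfl⟩ := hx
  obtain ⟨y, hy, rfl⟩ := hy
  exact ⟨x * y, TensorSkew.mul_mem_deg hx hy, map_mul (ofTensor k G V) x y⟩

theorem vec_mem_gradedPiece (v : V) : vec k G v ∈ gradedPiece k G V 1 := by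
  rw [gradedPiece_eq_map]
  exact ⟨_, TensorSkew.vec_mem_deg v, ofTensor_vec v⟩

theorem grp_mem_gradedPiece (g : G) : grp k V g ∈ gradedPiece k G V 0 := by
  rw [gradedPiece_eq_map]
  exact ⟨_, TensorSkew.grp_mem_deg g, ofTensor_grp g⟩

variable {d : ℕ} (b : Module.Basis (Fin d) k V)

/-- The element `b_{i₁} ⋯ b_{iₙ} g` of `S(V) # G`. -/
def word (w : List (Fin d)) (g : G) : Skew k G V :=
  (w.map fun i => vec k G (b i)).prod * grp k V g

theorem word_eq_single (w : List (Fin d)) (g : G) : word b w g =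
    SkewMonoidAlgebra.single g ((w : Multiset (Fin d)).map fun i => SymmetricAlgebra.ι k V (b i)).prod := by
  have := prod_vec_mul_grp (k := k) (w.map b) g
  rw [List.map_map, List.map_map] at this
  simpa [word, Function.comp_def] using this

theorem ofTensor_word (w : List (Fin d)) (g : G) :
    ofTensor k G V (TensorSkew.word b w g) = word b w g := by
  rw [TensorSkew.word, word, map_mul, map_list_prod, ofTensor_grp, List.map_map]
  congr 3
  ext v
  simp

theorem word_sort (w : List (Fin d)) (g : G) :
    word b (w : Multiset (Fin d)).sort g = word b w g := by
  rw [word_eq_single, word_eq_single, Multiset.sort_eq]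

theorem symmetricAlgebra_basis_apply (m : Multiset (Fin d)) :
    b.symmetricAlgebra (Multiset.toFinsupp m) =
      (m.map fun i => SymmetricAlgebra.ι k V (b i)).prod := by
  have h : MvPolynomial.monomial (Multiset.toFinsupp m) (1 : k) = (m.map MvPolynomial.X).prod := by
    induction m using Multiset.induction_on with
    | empty => simp
    | cons i m ih =>
      rw [Multiset.map_cons, Multiset.prod_cons, ← ih, ← Multiset.singleton_add, map_add,
        Multiset.toFinsupp_singleton, MvPolynomial.X, MvPolynomial.monomial_mul, one_mul]
  simp only [Module.Basis.symmetricAlgebra, Module.Basis.map_apply,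
    MvPolynomial.coe_basisMonomials, h]
  simp [map_multiset_prod]

/-- The basis of `S(V) # G` which consists of the sorted words in a basis of `V`, followed by a
group element. -/
def basis : Module.Basis (Multiset (Fin d) × G) k (Skew k G V) :=
  ((Finsupp.basis fun _ : G => b.symmetricAlgebra).map
    (SkewMonoidAlgebra.coeffLinearEquiv (S := k)).symm).reindex
    ((Equiv.sigmaEquivProd G (Fin d →₀ ℕ)).trans
      ((Equiv.prodComm _ _).trans
        (Equiv.prodCongr Multiset.toFinsupp.symm.toEquiv (Equiv.refl _))))

theorem basis_apply (m : Multiset (Fin d)) (g : G) : basis b (m, g) = word b m.sort g := by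
  rw [word_eq_single, Multiset.sort_eq, ← symmetricAlgebra_basis_apply]
  simp [basis, SkewMonoidAlgebra.coeffLinearEquiv, SkewMonoidAlgebra.coeffAddEquiv]

theorem word_eq_basis (w : List (Fin d)) (g : G) : word b w g = basis b (w, g) := by
  rw [basis_apply, word_sort]

theorem gradedPiece_eq_span (n : ℕ) : gradedPiece k G V n =
    Submodule.span k (basis b '' {x : Multiset (Fin d) × G | x.1.card = n}) := by
  rw [gradedPiece_eq_map, TensorSkew.deg_eq_span_word b, Submodule.map_span]
  congr 1
  ext x
  constructor
  · rintro ⟨_, ⟨w, g, hw, rfl⟩, rfl⟩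
    exact ⟨(w, g), by simpa using hw, by
      rw [← word_eq_basis, ← ofTensor_word]; rfl⟩
  · rintro ⟨⟨m, g⟩, hm, rfl⟩
    exact ⟨_, ⟨m.sort, g, by simpa using hm, rfl⟩, by
      rw [basis_apply, ← ofTensor_word]; rfl⟩

end Skew

end SkewGroup

end SkewGroupDeformation

end

/-! ### The PBW property of H_{0,κ} -/

noncomputable section

namespace SkewGroupDeformation

open Polynomial

/-- The isomorphism from the quotient by the kernel, for a target without negation. -/
def quotientEquivOfSurjective {k M N : Type*} [Ring k] [AddCommGroup M] [Module k M]
    [AddCommMonoid N] [Module k N] (f : M →ₗ[k] N) (hf : Function.Surjective f)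
    (p : Submodule k M) (hp : LinearMap.ker f = p) : (M ⧸ p) ≃ₗ[k] N :=
  letI : AddCommGroup N := Module.addCommMonoidToAddCommGroup k
  (Submodule.quotEquivOfEq _ _ hp.symm).trans (f.quotKerEquivOfSurjective hf)

section HeckePBW

variable {k : Type*} {G : Type*} {V : Type*} [Field k] [Group G] [AddCommGroup V] [Module k V]
  [DistribMulAction G V] (κ : V →ₗ[k] V →ₗ[k] MonoidAlgebra k G)

/-! ### The algebra `H_{0,κ}` as a quotient of `T(V) # G` -/

namespace Hecke

omit [Group G] [AddCommGroup V] [Module k V] [DistribMulAction G V] in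
theorem freeGrp_single (g : G) :
    freeGrp V (MonoidAlgebra.single g (1 : k)) = FreeAlgebra.ι k (Sum.inr g) := by
  simp [freeGrp]

theorem mk_eq {x y : FreeAlgebra k (V ⊕ G)} (h : HeckeRel 0 κ x y) :
    RingQuot.mkAlgHom k (HeckeRel 0 κ) x = RingQuot.mkAlgHom k (HeckeRel 0 κ) y :=
  RingQuot.mkAlgHom_rel k h

/-- The map from `V` to `H_{0,κ}`. -/
def vecHom : V →ₗ[k] Hecke 0 κ where
  toFun v := gen 0 κ (Sum.inl v)
  map_add' v w := (mk_eq κ (HeckeRel.vec_add v w)).trans (map_add _ _ _)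
  map_smul' c v := (mk_eq κ (HeckeRel.vec_smul c v)).trans (map_smul _ _ _)

/-- The map from `G` to `H_{0,κ}`. -/
def grpHom : G →* Hecke 0 κ where
  toFun g := gen 0 κ (Sum.inr g)
  map_one' := by
    have h := mk_eq κ HeckeRel.grp_one
    rw [freeGrp_single, map_one] at h
    exact h
  map_mul' g h := by
    have h := mk_eq κ (HeckeRel.grp_mul g h)
    rw [freeGrp_single, freeGrp_single, freeGrp_single, map_mul] at h
    exact h

theorem mk_freeGrp (x : MonoidAlgebra k G) : RingQuot.mkAlgHom k (HeckeRel 0 κ) (freeGrp V x) =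
    MonoidAlgebra.lift k (Hecke 0 κ) G (grpHom κ) x := by
  rw [MonoidAlgebra.lift_apply, freeGrp, Finsupp.sum, map_sum]
  refine Finset.sum_congr rfl fun g _ => ?_
  rw [map_smul]
  rfl

theorem grpHom_mul_vecHom (g : G) (v : V) :
    grpHom κ g * vecHom κ v = vecHom κ (g • v) * grpHom κ g := by
  have h := mk_eq κ (HeckeRel.act g v)
  rw [LinearMap.zero_apply, LinearMap.zero_apply, map_sub, map_mul, map_mul, freeGrp_single] at h
  have h0 : freeGrp (k := k) (G := G) V 0 = 0 := by simp [freeGrp]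
  rw [h0, map_zero, sub_eq_zero] at h
  exact h

theorem vecHom_mul_vecHom_sub (v w : V) : vecHom κ v * vecHom κ w - vecHom κ w * vecHom κ v =
    MonoidAlgebra.lift k (Hecke 0 κ) G (grpHom κ) (κ v w) := by
  have h := mk_eq κ (HeckeRel.comm v w)
  rw [mk_freeGrp] at h
  rw [sub_eq_iff_eq_add, ← h]
  have h1 := congrArg (RingQuot.mkAlgHom k (HeckeRel 0 κ))
    (sub_add_cancel (freeVec k G v * freeVec k G w) (freeVec k G w * freeVec k G v))
  rw [map_add, map_mul, map_mul] at h1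
  exact h1.symm

variable [SMulCommClass G k V]

/-- The map from the quotient of `T(V) # G` to `H_{0,κ}`. -/
def ofSkewQuotient : SkewQuotient κ →ₐ[k] Hecke 0 κ :=
  SkewQuotient.lift (vecHom κ) (grpHom κ) (grpHom_mul_vecHom κ) (vecHom_mul_vecHom_sub κ)

/-- The map from `H_{0,κ}` to the quotient of `T(V) # G`. -/
def toSkewQuotient : Hecke 0 κ →ₐ[k] SkewQuotient κ :=
  RingQuot.liftAlgHom k ⟨FreeAlgebra.lift k (Sum.elim (SkewQuotient.vec κ) (SkewQuotient.grp κ)), by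
    have hG : ∀ x : MonoidAlgebra k G,
        FreeAlgebra.lift k (Sum.elim (SkewQuotient.vec κ) (SkewQuotient.grp κ)) (freeGrp V x) =
          MonoidAlgebra.lift k _ G (SkewQuotient.grp κ) x := fun x => by
      rw [MonoidAlgebra.lift_apply, freeGrp, Finsupp.sum, map_sum]
      refine Finset.sum_congr rfl fun g _ => ?_
      simp
    intro x y h
    cases h with
    | vec_add v w => simp [freeVec]
    | vec_smul c v => simp [freeVec]
    | grp_one => simp [hG]
    | grp_mul g h => simp [hG]
    | comm v w => rw [hG, ← SkewQuotient.vec_mul_vec_sub]; simp [freeVec]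
    | act g v => rw [hG, map_sub, map_mul, map_mul, hG]; simp [freeVec, SkewQuotient.grp_mul_vec]⟩

theorem toSkewQuotient_gen (x : V ⊕ G) : toSkewQuotient κ (gen 0 κ x) =
    Sum.elim (SkewQuotient.vec κ) (SkewQuotient.grp κ) x := by
  change RingQuot.liftAlgHom k _ (RingQuot.mkAlgHom k (HeckeRel 0 κ) (FreeAlgebra.ι k x)) = _
  rw [RingQuot.liftAlgHom_mkAlgHom_apply, FreeAlgebra.lift_ι_apply]

theorem ofSkewQuotient_vec (v : V) :
    ofSkewQuotient κ (SkewQuotient.vec κ v) = gen 0 κ (Sum.inl v) :=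
  SkewQuotient.lift_vec _ _ _ _ v

theorem ofSkewQuotient_grp (g : G) :
    ofSkewQuotient κ (SkewQuotient.grp κ g) = gen 0 κ (Sum.inr g) :=
  SkewQuotient.lift_grp _ _ _ _ g

/-- `H_{0,κ}` is the quotient of `T(V) # G` by the relations `v w - w v = κ(v, w)`. -/
def equivSkewQuotient : Hecke 0 κ ≃ₐ[k] SkewQuotient κ :=
  AlgEquiv.ofAlgHom (toSkewQuotient κ) (ofSkewQuotient κ)
    (SkewQuotient.hom_ext
      (fun v => by
        rw [AlgHom.comp_apply, ofSkewQuotient_vec, toSkewQuotient_gen]; rfl)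
      (fun g => by
        rw [AlgHom.comp_apply, ofSkewQuotient_grp, toSkewQuotient_gen]; rfl))
    (by
      apply RingQuot.ringQuot_ext'
      apply FreeAlgebra.hom_ext
      funext x
      change ofSkewQuotient κ (toSkewQuotient κ (gen 0 κ x)) = gen 0 κ x
      rw [toSkewQuotient_gen]
      rcases x with v | g
      · exact ofSkewQuotient_vec κ v
      · exact ofSkewQuotient_grp κ g)

theorem equivSkewQuotient_gen (x : V ⊕ G) : equivSkewQuotient κ (gen 0 κ x) =
    Sum.elim (SkewQuotient.vec κ) (SkewQuotient.grp κ) x :=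
  toSkewQuotient_gen κ x

end Hecke

/-! ### Leading terms -/

namespace SkewQuotient

variable [SMulCommClass G k V] {κ} {d : ℕ} (b : Module.Basis (Fin d) k V) (hκ : IsPBWForm κ)

/-- The leading term of degree `n` of an element of degree at most `n`. -/
def lead (n : ℕ) : SkewQuotient κ →ₗ[k] Skew k G V :=
  (pbwBasis b hκ).constr k fun x => if x.1.card = n then Skew.basis b x else 0

theorem lead_pbwBasis (n : ℕ) (x : Multiset (Fin d) × G) :
    lead b hκ n (pbwBasis b hκ x) = if x.1.card = n then Skew.basis b x else 0 := by
  rw [lead, Module.Basis.constr_basis]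

theorem lead_of_mem_lowSpan {n : ℕ} {x : SkewQuotient κ} (hx : x ∈ lowSpan b κ n) :
    lead b hκ n x = 0 := by
  induction hx using Submodule.span_induction with
  | mem x hx =>
    obtain ⟨m, g, hm, rfl⟩ := hx
    rw [← pbwBasis_apply b hκ, lead_pbwBasis, if_neg hm.ne]
  | zero => simp
  | add x y _ _ hx hy => rw [map_add, hx, hy, add_zero]
  | smul c x _ hx => rw [map_smul, hx, smul_zero]

theorem mk_mem_lowSpan {n : ℕ} {x : TensorSkew k G V} (hx : x ∈ TensorSkew.deg k G V n) :
    mk κ x ∈ lowSpan b κ (n + 1) := by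
  rw [TensorSkew.deg_eq_span_word b] at hx
  induction hx using Submodule.span_induction with
  | mem x hx =>
    obtain ⟨w, g, hw, rfl⟩ := hx
    rw [mk_word, ← sub_add_cancel (word b w g) (word b (w : Multiset (Fin d)).sort g)]
    exact add_mem (lowSpan_mono b (by omega) (word_sub_mem_lowSpan b w g))
      (Submodule.subset_span ⟨_, g, by simp [hw], rfl⟩)
  | zero => simp
  | add x y _ _ hx hy => rw [map_add]; exact add_mem hx hy
  | smul c x _ hx => rw [map_smul]; exact Submodule.smul_mem _ _ hx

/-- The leading term is defined by a basis, but on classes of homogeneous tensors it is the algebra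
map to S(V) # G. Its multiplicativity comes from here. -/
theorem lead_mk {n : ℕ} {x : TensorSkew k G V} (hx : x ∈ TensorSkew.deg k G V n) :
    lead b hκ n (mk κ x) = Skew.ofTensor k G V x := by
  rw [TensorSkew.deg_eq_span_word b] at hx
  induction hx using Submodule.span_induction with
  | mem x hx =>
    obtain ⟨w, g, rfl, rfl⟩ := hx
    rw [mk_word, ← sub_add_cancel (word b w g) (word b (w : Multiset (Fin d)).sort g), map_add,
      lead_of_mem_lowSpan b hκ (word_sub_mem_lowSpan b w g), ← pbwBasis_apply b hκ, lead_pbwBasis,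
      Skew.ofTensor_word, Skew.word_eq_basis]
    simp
  | zero => simp
  | add x y _ _ hx hy => rw [map_add, map_add, map_add, hx, hy]
  | smul c x _ hx => rw [map_smul, map_smul, map_smul, hx]

theorem lead_mk_of_lt {m n : ℕ} (hmn : m < n) {x : TensorSkew k G V}
    (hx : x ∈ TensorSkew.deg k G V m) : lead b hκ n (mk κ x) = 0 :=
  lead_of_mem_lowSpan b hκ (lowSpan_mono b hmn (mk_mem_lowSpan b hx))

include hκ in
theorem lowSpan_eq_span_image (n : ℕ) : lowSpan b κ n =
    Submodule.span k (pbwBasis b hκ '' {x : Multiset (Fin d) × G | x.1.card < n}) := by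
  rw [lowSpan]
  congr 1
  ext x
  constructor
  · rintro ⟨m, g, hm, rfl⟩
    exact ⟨(m, g), hm, pbwBasis_apply b hκ m g⟩
  · rintro ⟨⟨m, g⟩, hm, rfl⟩
    exact ⟨m, g, hm, pbwBasis_apply b hκ m g⟩

theorem repr_lead {n : ℕ} (x : SkewQuotient κ) {y : Multiset (Fin d) × G} (hy : y.1.card = n) :
    (Skew.basis b).repr (lead b hκ n x) y = (pbwBasis b hκ).repr x y := by
  classical
  have h : (Skew.basis b).coord y ∘ₗ lead b hκ n = (pbwBasis b hκ).coord y := by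
    refine (pbwBasis b hκ).ext fun z => ?_
    rw [LinearMap.comp_apply, lead_pbwBasis]
    split_ifs with hz
    · simp [Finsupp.single_apply]
    · have : z ≠ y := fun h => hz (h ▸ hy)
      simp [this]
  exact DFunLike.congr_fun h x

theorem mem_lowSpan_of_lead_eq_zero {n : ℕ} {x : SkewQuotient κ} (hx : x ∈ lowSpan b κ (n + 1))
    (h : lead b hκ n x = 0) : x ∈ lowSpan b κ n := by
  rw [lowSpan_eq_span_image b hκ, Module.Basis.mem_span_image] at hx ⊢
  intro y hy
  have h1 : y.1.card < n + 1 := hx hy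
  refine lt_of_le_of_ne (Nat.lt_succ_iff.1 h1) fun h2 => ?_
  have h3 := repr_lead b hκ x h2
  rw [h] at h3
  simp at hy h3
  exact hy h3.symm

end SkewQuotient

/-! ### The Poincaré-Birkhoff-Witt property of `H_{0,κ}` -/

namespace Hecke

variable [SMulCommClass G k V]

variable (k) in
/-- A word in vectors and group elements as an element of `T(V) # G`. -/
def letters (w : List (V ⊕ G)) : TensorSkew k G V :=
  (w.map (Sum.elim (TensorSkew.vec k G) (TensorSkew.grp k V))).prod

theorem letters_mem_deg (w : List (V ⊕ G)) :
    letters k w ∈ TensorSkew.deg k G V (w.countP Sum.isLeft) := by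
  induction w with
  | nil => simpa [letters] using TensorSkew.grp_mem_deg (k := k) (V := V) (1 : G)
  | cons x w ih =>
    rw [letters, List.map_cons, List.prod_cons, List.countP_cons, add_comm]
    refine TensorSkew.mul_mem_deg ?_ ih
    rcases x with v | g
    · exact TensorSkew.vec_mem_deg v
    · exact TensorSkew.grp_mem_deg g

theorem equivSkewQuotient_prod (w : List (V ⊕ G)) :
    equivSkewQuotient κ (w.map (gen 0 κ)).prod = SkewQuotient.mk κ (letters k w) := by
  rw [letters, map_list_prod, map_list_prod, List.map_map, List.map_map]
  congr 2
  funext x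
  rw [Function.comp_apply, equivSkewQuotient_gen]
  rcases x with v | g <;> rfl

theorem symm_mk_mem_filtration {n : ℕ} {x : TensorSkew k G V} (hx : x ∈ TensorSkew.deg k G V n) :
    (equivSkewQuotient κ).symm (SkewQuotient.mk κ x) ∈ filtration 0 κ n := by
  induction hx using Submodule.span_induction with
  | mem x hx =>
    obtain ⟨l, g, hl, rfl⟩ := hx
    refine Submodule.subset_span ⟨l.map Sum.inl ++ [Sum.inr g], ?_, ?_⟩
    · simp [List.countP_map, Function.comp_def, hl]
    · rw [AlgEquiv.symm_apply_eq, equivSkewQuotient_prod]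
      simp [letters, Function.comp_def]
  | zero => simp
  | add x y _ _ hx hy => rw [map_add, map_add]; exact add_mem hx hy
  | smul c x _ hx => rw [map_smul, map_smul]; exact Submodule.smul_mem _ _ hx

omit [SMulCommClass G k V] in
theorem filtration_mono {m n : ℕ} (h : m ≤ n) : filtration 0 κ m ≤ filtration 0 κ n :=
  Submodule.span_mono fun _ ⟨w, hw, hx⟩ => ⟨w, hw.trans h, hx⟩

variable {κ} {d : ℕ} (b : Module.Basis (Fin d) k V) (hκ : IsPBWForm κ)

/-- `lowSpan` uses lengths strictly below n, and so matches the step n − 1 of the filtration; for n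
= 0 both are zero. -/
theorem symm_mem_filtrationPred {n : ℕ} {x : SkewQuotient κ}
    (hx : x ∈ SkewQuotient.lowSpan b κ n) :
    (equivSkewQuotient κ).symm x ∈ filtrationPred 0 κ n := by
  induction hx using Submodule.span_induction with
  | mem x hx =>
    obtain ⟨m, g, hm, rfl⟩ := hx
    cases n with
    | zero => simp at hm
    | succ n =>
      have h1 := TensorSkew.word_mem_deg b m.sort g
      rw [Multiset.length_sort] at h1
      rw [← SkewQuotient.mk_word]
      exact filtration_mono κ (Nat.lt_succ_iff.1 hm) (symm_mk_mem_filtration κ h1)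
  | zero => simp
  | add x y _ _ hx hy => rw [map_add]; exact add_mem hx hy
  | smul c x _ hx => rw [map_smul]; exact Submodule.smul_mem _ _ hx

/-- The leading term of degree `n` of an element of `filtration n`. -/
def lead (n : ℕ) : Hecke 0 κ →ₗ[k] Skew k G V :=
  SkewQuotient.lead b hκ n ∘ₗ (equivSkewQuotient κ).toLinearMap

theorem lead_prod {n : ℕ} {w : List (V ⊕ G)} (hw : w.countP Sum.isLeft ≤ n) :
    lead b hκ n (w.map (gen 0 κ)).prod =
      if w.countP Sum.isLeft = n then Skew.ofTensor k G V (letters k w) else 0 := by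
  change SkewQuotient.lead b hκ n (equivSkewQuotient κ _) = _
  rw [equivSkewQuotient_prod]
  split_ifs with h
  · exact SkewQuotient.lead_mk b hκ (h ▸ letters_mem_deg w)
  · exact SkewQuotient.lead_mk_of_lt b hκ (lt_of_le_of_ne hw h) (letters_mem_deg w)

theorem lead_mem_gradedPiece {n : ℕ} {x : Hecke 0 κ} (hx : x ∈ filtration 0 κ n) :
    lead b hκ n x ∈ gradedPiece k G V n := by
  induction hx using Submodule.span_induction with
  | mem x hx =>
    obtain ⟨w, hw, rfl⟩ := hx
    rw [lead_prod b hκ hw]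
    split_ifs with h
    · rw [Skew.gradedPiece_eq_map]
      exact ⟨_, h ▸ letters_mem_deg w, rfl⟩
    · exact zero_mem _
  | zero => simp
  | add x y _ _ hx hy => rw [map_add]; exact add_mem hx hy
  | smul c x _ hx => rw [map_smul]; exact Submodule.smul_mem _ _ hx

/-- On words: if one factor has fewer vectors than its filtration degree allows, then so has the
product and both sides vanish; otherwise both are images under `Skew.ofTensor`. -/
theorem lead_mul {m n : ℕ} {x y : Hecke 0 κ} (hx : x ∈ filtration 0 κ m)
    (hy : y ∈ filtration 0 κ n) :
    lead b hκ (m + n) (x * y) = lead b hκ m x * lead b hκ n y := by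
  induction hx using Submodule.span_induction with
  | mem x hx =>
    obtain ⟨w, hw, rfl⟩ := hx
    induction hy using Submodule.span_induction with
    | mem y hy =>
      obtain ⟨w', hw', rfl⟩ := hy
      rw [← List.prod_append, ← List.map_append, lead_prod b hκ hw, lead_prod b hκ hw',
        lead_prod b hκ (by rw [List.countP_append]; omega), List.countP_append]
      by_cases h : w.countP Sum.isLeft = m
      · by_cases h' : w'.countP Sum.isLeft = n
        · rw [if_pos h, if_pos h', if_pos (by omega), ← map_mul]
          simp [letters]
        · rw [if_neg h', if_neg (by omega), mul_zero]
      · rw [if_neg h, if_neg (by omega), zero_mul]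
    | zero => simp
    | add x y _ _ hx hy => rw [mul_add, map_add, map_add, hx, hy, mul_add]
    | smul c x _ hx => rw [mul_smul_comm, map_smul, map_smul, hx, mul_smul_comm]
  | zero => simp
  | add x y _ _ hx hy => rw [add_mul, map_add, map_add, hx, hy, add_mul]
  | smul c x _ hx => rw [smul_mul_assoc, map_smul, map_smul, hx, smul_mul_assoc]

theorem equivSkewQuotient_mem_lowSpan {n : ℕ} {x : Hecke 0 κ} (hx : x ∈ filtration 0 κ n) :
    equivSkewQuotient κ x ∈ SkewQuotient.lowSpan b κ (n + 1) := by
  induction hx using Submodule.span_induction with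
  | mem x hx =>
    obtain ⟨w, hw, rfl⟩ := hx
    rw [equivSkewQuotient_prod]
    exact SkewQuotient.lowSpan_mono b (by omega)
      (SkewQuotient.mk_mem_lowSpan b (letters_mem_deg w))
  | zero => simp
  | add x y _ _ hx hy => rw [map_add]; exact add_mem hx hy
  | smul c x _ hx => rw [map_smul]; exact Submodule.smul_mem _ _ hx

theorem lead_eq_zero_iff {n : ℕ} {x : Hecke 0 κ} (hx : x ∈ filtration 0 κ n) :
    lead b hκ n x = 0 ↔ x ∈ filtrationPred 0 κ n := by
  constructor
  · intro h
    have h1 := symm_mem_filtrationPred b (SkewQuotient.mem_lowSpan_of_lead_eq_zero b hκ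
      (equivSkewQuotient_mem_lowSpan b hx) h)
    rwa [AlgEquiv.symm_apply_apply] at h1
  · intro h
    cases n with
    | zero =>
      have : x = 0 := h
      rw [this, map_zero]
    | succ n => exact SkewQuotient.lead_of_mem_lowSpan b hκ (equivSkewQuotient_mem_lowSpan b h)

/-- The leading term, as a map from `filtration n` to the homogeneous component of degree `n`. -/
def leadPiece (n : ℕ) : filtration 0 κ n →ₗ[k] gradedPiece k G V n :=
  (lead b hκ n).restrict fun _ hx => lead_mem_gradedPiece b hκ hx

theorem leadPiece_surjective (n : ℕ) : Function.Surjective (leadPiece b hκ n) := by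
  rintro ⟨y, hy⟩
  have hy' := hy
  rw [Skew.gradedPiece_eq_map] at hy'
  obtain ⟨x, hx, rfl⟩ := hy'
  refine ⟨⟨_, symm_mk_mem_filtration κ hx⟩, Subtype.ext ?_⟩
  change SkewQuotient.lead b hκ n (equivSkewQuotient κ ((equivSkewQuotient κ).symm _)) = _
  rw [AlgEquiv.apply_symm_apply, SkewQuotient.lead_mk b hκ hx]
  rfl

theorem ker_leadPiece (n : ℕ) : LinearMap.ker (leadPiece b hκ n) =
    (filtrationPred 0 κ n).submoduleOf (filtration 0 κ n) := by
  ext x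
  have h : leadPiece b hκ n x = 0 ↔ lead b hκ n x = 0 := Subtype.ext_iff
  rw [LinearMap.mem_ker, h, lead_eq_zero_iff b hκ x.2]
  rfl

/-- The leading term, as an isomorphism from the component of degree `n` of the associated graded
algebra. -/
def grEquiv (n : ℕ) : GrPiece 0 κ n ≃ₗ[k] gradedPiece k G V n :=
  quotientEquivOfSurjective (leadPiece b hκ n) (leadPiece_surjective b hκ n) _
    (ker_leadPiece b hκ n)

theorem grEquiv_symbol (n : ℕ) (x : filtration 0 κ n) :
    (grEquiv b hκ n (symbol 0 κ n x) : Skew k G V) = lead b hκ n x := rfl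

include hκ in
theorem hasPBW [FiniteDimensional k V] : HasPBW 0 κ := by
  refine ⟨grEquiv (Module.finBasis k V) hκ, ?_, ?_⟩
  · rw [grEquiv_symbol]
    have h := lead_prod (Module.finBasis k V) hκ (n := 0) (w := []) (by simp)
    simpa [letters] using h
  · intro m n x y
    rw [grEquiv_symbol, grEquiv_symbol, grEquiv_symbol]
    exact lead_mul _ hκ x.2 y.2

end Hecke

end HeckePBW

end SkewGroupDeformation

end

noncomputable section

namespace SkewGroupDeformation

open Polynomial

/-! ### The square-zero extension defined by a Hochschild 2-cocycle -/

section SquareZero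

variable {k : Type*} {A : Type*} [Field k] [Ring A] [Algebra k A]

/-- The square-zero extension `A ⊕ A ε` of `A` defined by a Hochschild 2-cocycle `μ` with
`μ(1, 1) = 0`: the product of `a` and `b` in `A` is `a b + μ(a, b) ε`. -/
@[ext]
structure SquareZero (μ : A →ₗ[k] A →ₗ[k] A) (hμ : IsHochschildTwoCocycle μ) (h1 : μ 1 1 = 0) where
  fst : A
  snd : A

namespace SquareZero

variable {μ : A →ₗ[k] A →ₗ[k] A} {hμ : IsHochschildTwoCocycle μ} {h1 : μ 1 1 = 0}

/-- The underlying pair. -/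
def equivProd : SquareZero μ hμ h1 ≃ A × A where
  toFun x := (x.fst, x.snd)
  invFun x := ⟨x.1, x.2⟩

instance : AddCommGroup (SquareZero μ hμ h1) := equivProd.addCommGroup

instance : Module k (SquareZero μ hμ h1) := equivProd.module k

@[simp] theorem fst_zero : (0 : SquareZero μ hμ h1).fst = 0 := rfl
@[simp] theorem snd_zero : (0 : SquareZero μ hμ h1).snd = 0 := rfl
@[simp] theorem fst_add (x y : SquareZero μ hμ h1) : (x + y).fst = x.fst + y.fst := rfl
@[simp] theorem snd_add (x y : SquareZero μ hμ h1) : (x + y).snd = x.snd + y.snd := rfl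
@[simp] theorem fst_sub (x y : SquareZero μ hμ h1) : (x - y).fst = x.fst - y.fst := rfl
@[simp] theorem snd_sub (x y : SquareZero μ hμ h1) : (x - y).snd = x.snd - y.snd := rfl
@[simp] theorem fst_smul (c : k) (x : SquareZero μ hμ h1) : (c • x).fst = c • x.fst := rfl
@[simp] theorem snd_smul (c : k) (x : SquareZero μ hμ h1) : (c • x).snd = c • x.snd := rfl

instance : Mul (SquareZero μ hμ h1) :=
  ⟨fun x y => ⟨x.fst * y.fst, x.fst * y.snd + x.snd * y.fst + μ x.fst y.fst⟩⟩

instance : One (SquareZero μ hμ h1) := ⟨⟨1, 0⟩⟩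

@[simp] theorem fst_one : (1 : SquareZero μ hμ h1).fst = 1 := rfl
@[simp] theorem snd_one : (1 : SquareZero μ hμ h1).snd = 0 := rfl
@[simp] theorem fst_mul (x y : SquareZero μ hμ h1) : (x * y).fst = x.fst * y.fst := rfl
@[simp] theorem snd_mul (x y : SquareZero μ hμ h1) :
    (x * y).snd = x.fst * y.snd + x.snd * y.fst + μ x.fst y.fst := rfl

/-- The cocycle identity at (1, 1, a) reads μ(1, a) = μ(1, 1) a. Together with its mirror image,
this makes (1, 0) a unit of the extension. -/
theorem cocycle_one_left (hμ : IsHochschildTwoCocycle μ) (h1 : μ 1 1 = 0) (a : A) : μ 1 a = 0 := by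
  have h := hμ 1 1 a
  simpa [h1] using h

theorem cocycle_one_right (hμ : IsHochschildTwoCocycle μ) (h1 : μ 1 1 = 0) (a : A) : μ a 1 = 0 := by
  have h := hμ a 1 1
  simpa [h1] using h

instance : Ring (SquareZero μ hμ h1) :=
  { (inferInstance : AddCommGroup (SquareZero μ hμ h1)),
    (inferInstance : Mul (SquareZero μ hμ h1)), (inferInstance : One (SquareZero μ hμ h1)) with
    mul_assoc := fun x y z => by
      ext
      · simp [mul_assoc]
      -- Associativity in the ε-component is the cocycle identity.
      · have h := hμ x.fst y.fst z.fst
        simp only [fst_mul, snd_mul, mul_add, add_mul]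
        have h' : μ x.fst (y.fst * z.fst) = μ (x.fst * y.fst) z.fst + μ x.fst y.fst * z.fst
            - x.fst * μ y.fst z.fst := by rw [← h]; abel
        rw [h']
        noncomm_ring
    one_mul := fun x => by ext <;> simp [cocycle_one_left (hμ := hμ) (h1 := h1)]
    mul_one := fun x => by ext <;> simp [cocycle_one_right (hμ := hμ) (h1 := h1)]
    left_distrib := fun x y z => by
      ext
      · simp [mul_add]
      · simp only [snd_mul, fst_add, snd_add, mul_add, map_add]; abel
    right_distrib := fun x y z => by
      ext
      · simp [add_mul]
      · simp only [snd_mul, fst_add, snd_add, add_mul, map_add, LinearMap.add_apply]; abel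
    zero_mul := fun x => by ext <;> simp
    mul_zero := fun x => by ext <;> simp }

instance : Algebra k (SquareZero μ hμ h1) :=
  Algebra.ofModule (fun r x y => by ext <;> simp [smul_add]) (fun r x y => by ext <;> simp [smul_add])

end SquareZero

end SquareZero

/-! ### Recovering elements of kG and V from their images in S(V) # G -/

section Kappa

variable {k : Type*} {G : Type*} {V : Type*} [Field k] [Group G] [AddCommGroup V] [Module k V]
  [DistribMulAction G V] [SMulCommClass G k V]

/-- The algebra map from S(V) to the trivial square-zero extension k ⊕ V recovers v. -/
theorem symmetricAlgebra_ι_injective : Function.Injective (SymmetricAlgebra.ι k V) := by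
  let : Module kᵐᵒᵖ V := Module.compHom _ ((RingHom.id k).fromOpposite mul_comm)
  have : IsCentralScalar k V := ⟨fun _ _ => rfl⟩
  intro v w h
  have h1 := congrArg (SymmetricAlgebra.lift (TrivSqZeroExt.inrHom k V)) h
  rw [SymmetricAlgebra.lift_ι_apply, SymmetricAlgebra.lift_ι_apply] at h1
  exact TrivSqZeroExt.inr_injective h1

namespace Skew

variable (k G V) in
/-- The projection from `S(V) # G` to `kG` which sends `V` to zero. -/
def toGroup : Skew k G V →ₗ[k] MonoidAlgebra k G :=
  (MonoidAlgebra.coeffLinearEquiv k).symm.toLinearMap ∘ₗ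
    (Finsupp.mapRange.linearMap (SymmetricAlgebra.algebraMapInv (M := V)).toLinearMap) ∘ₗ
      (SkewMonoidAlgebra.coeffLinearEquiv (S := k)).toLinearMap

omit [Group G] [DistribMulAction G V] [SMulCommClass G k V] in
theorem toGroup_single (g : G) (c : k) :
    toGroup k G V (SkewMonoidAlgebra.single g (algebraMap k _ c)) = MonoidAlgebra.single g c := by
  ext h
  simp [toGroup, SkewMonoidAlgebra.coeffLinearEquiv, SkewMonoidAlgebra.coeffAddEquiv]

theorem groupIncl_single' (g : G) (c : k) : groupIncl k G V (MonoidAlgebra.single g c) =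
    SkewMonoidAlgebra.single g (algebraMap k _ c) := by
  rw [groupIncl, MonoidAlgebra.lift_single, SkewMonoidAlgebra.of_apply,
    SkewMonoidAlgebra.smul_single, Algebra.algebraMap_eq_smul_one]

theorem toGroup_groupIncl (x : MonoidAlgebra k G) : toGroup k G V (groupIncl k G V x) = x := by
  have h : toGroup k G V ∘ₗ (groupIncl k G V).toLinearMap = LinearMap.id := by
    ext g : 2
    have h1 := toGroup_single (V := V) g (1 : k)
    rw [map_one] at h1
    simp [groupIncl_single', h1]
  exact DFunLike.congr_fun h x

theorem groupIncl_injective : Function.Injective (groupIncl k G V) :=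
  Function.LeftInverse.injective toGroup_groupIncl

theorem groupIncl_toGroup {x : Skew k G V} (hx : x ∈ gradedPiece k G V 0) :
    groupIncl k G V (toGroup k G V x) = x := by
  rw [gradedPiece_eq_map] at hx
  obtain ⟨y, hy, rfl⟩ := hx
  induction hy using Submodule.span_induction with
  | mem y hy =>
    obtain ⟨l, g, hl, rfl⟩ := hy
    obtain rfl := List.length_eq_zero_iff.1 hl
    change groupIncl k G V (toGroup k G V (ofTensor k G V _)) = ofTensor k G V _
    rw [ofTensor_prod, List.map_nil, List.prod_nil, ← map_one (algebraMap k _), toGroup_single,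
      groupIncl_single']
  | zero => rw [map_zero, map_zero, map_zero]
  | add x y _ _ hx hy => rw [map_add, map_add, map_add, hx, hy]
  | smul c x _ hx => rw [map_smul, map_smul, map_smul, hx]

/-- From v g − g v = (v − g v) g. It turns the Jacobi identity in S(V) # G into the condition in V,
one group element at a time. -/
theorem coeff_vec_commutator (v : V) (x : MonoidAlgebra k G) (g : G) :
    (vec k G v * groupIncl k G V x).coeff g - (groupIncl k G V x * vec k G v).coeff g =
      SymmetricAlgebra.ι k V (x.coeff g • (v - g • v)) := by
  classical
  induction x using MonoidAlgebra.induction_linear with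
  | zero => simp
  | add x y hx hy =>
    rw [map_add, mul_add, add_mul, SkewMonoidAlgebra.coeff_add, SkewMonoidAlgebra.coeff_add,
      MonoidAlgebra.coeff_add, Finsupp.add_apply, Finsupp.add_apply, Finsupp.add_apply, add_smul,
      map_add, ← hx, ← hy]
    ring
  | single h c =>
    rw [groupIncl_single', vec, SkewMonoidAlgebra.single_mul_single,
      SkewMonoidAlgebra.single_mul_single, SkewMonoidAlgebra.coeff_single_apply,
      SkewMonoidAlgebra.coeff_single_apply, one_mul, mul_one, one_smul,
      MonoidAlgebra.coeff_single, Finsupp.single_apply]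
    split_ifs with hgh
    · subst hgh
      rw [LinearMap.map_smul, smul_ι, map_sub, Algebra.smul_def, mul_sub, mul_comm]
    · simp

end Skew

end Kappa

end SkewGroupDeformation

end

noncomputable section

namespace SkewGroupDeformation

open Polynomial

section KappaZero

variable {k : Type*} {G : Type*} {V : Type*} [Field k] [Group G] [AddCommGroup V] [Module k V]
  [DistribMulAction G V] [SMulCommClass G k V]
  (κ : Skew k G V →ₗ[k] Skew k G V →ₗ[k] Skew k G V)

/-! ### The form on `V` defined by a Hochschild 2-cocycle of degree `-2` -/

/-- The form `κ(v, w) - κ(w, v)` on `V`, with values in `kG`. -/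
def vectorForm : V →ₗ[k] V →ₗ[k] MonoidAlgebra k G :=
  LinearMap.mk₂ k (fun v w => Skew.toGroup k G V (κ (Skew.vecHom k G V v) (Skew.vecHom k G V w)) -
      Skew.toGroup k G V (κ (Skew.vecHom k G V w) (Skew.vecHom k G V v)))
    (fun u v w => by simp only [map_add, LinearMap.add_apply]; abel)
    (fun c v w => by simp only [map_smul, LinearMap.smul_apply, smul_sub])
    (fun u v w => by simp only [map_add, LinearMap.add_apply]; abel)
    (fun c v w => by simp only [map_smul, LinearMap.smul_apply, smul_sub])

variable {κ} (hcocycle : IsHochschildTwoCocycle κ) (hdegree : IsHomogeneousOfDegree κ (-2))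
include hdegree

/-- The value has degree −2, where the graded piece is ⊥ by definition. The next two values have
degree −1. -/
theorem cocycle_grp_grp (g h : G) : κ (Skew.grp k V g) (Skew.grp k V h) = 0 :=
  hdegree 0 0 _ (Skew.grp_mem_gradedPiece g) _ (Skew.grp_mem_gradedPiece h)

theorem cocycle_grp_vec (g : G) (v : V) : κ (Skew.grp k V g) (vec k G v) = 0 :=
  hdegree 0 1 _ (Skew.grp_mem_gradedPiece g) _ (Skew.vec_mem_gradedPiece v)

theorem cocycle_vec_grp (g : G) (v : V) : κ (vec k G v) (Skew.grp k V g) = 0 :=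
  hdegree 1 0 _ (Skew.vec_mem_gradedPiece v) _ (Skew.grp_mem_gradedPiece g)

theorem cocycle_one_one : κ 1 1 = 0 := by
  have h := cocycle_grp_grp hdegree 1 1
  rwa [map_one] at h

theorem cocycle_vec_vec_mem (v w : V) : κ (vec k G v) (vec k G w) ∈ gradedPiece k G V 0 :=
  hdegree 1 1 _ (Skew.vec_mem_gradedPiece v) _ (Skew.vec_mem_gradedPiece w)

theorem groupIncl_vectorForm (v w : V) : groupIncl k G V (vectorForm κ v w) =
    κ (vec k G v) (vec k G w) - κ (vec k G w) (vec k G v) := by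
  change groupIncl k G V (Skew.toGroup k G V (κ (vec k G v) (vec k G w)) -
    Skew.toGroup k G V (κ (vec k G w) (vec k G v))) = _
  rw [map_sub, Skew.groupIncl_toGroup (cocycle_vec_vec_mem hdegree v w),
    Skew.groupIncl_toGroup (cocycle_vec_vec_mem hdegree w v)]

omit hdegree in
theorem vectorForm_self (v : V) : vectorForm κ v v = 0 := sub_self _

include hcocycle

/-- The square-zero extension of `S(V) # G` defined by `κ`. -/
abbrev KappaExt : Type _ := SquareZero κ hcocycle (cocycle_one_one hdegree)

namespace KappaExt

/-- The lift of `V` to the square-zero extension. -/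
def vecHom : V →ₗ[k] KappaExt hcocycle hdegree where
  toFun v := ⟨Skew.vecHom k G V v, 0⟩
  map_add' v w := by ext1 <;> simp only [map_add, SquareZero.fst_add, SquareZero.snd_add, add_zero]
  map_smul' c v := by
    ext1 <;> simp only [map_smul, SquareZero.fst_smul, SquareZero.snd_smul, smul_zero,
      RingHom.id_apply]

/-- The lift of `G` to the square-zero extension. -/
def grpHom : G →* KappaExt hcocycle hdegree where
  toFun g := ⟨Skew.grp k V g, 0⟩
  map_one' := by ext1 <;> simp only [map_one, SquareZero.fst_one, SquareZero.snd_one]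
  map_mul' g h := by
    ext1 <;> simp only [map_mul, SquareZero.fst_mul, SquareZero.snd_mul, mul_zero, zero_mul,
      add_zero, cocycle_grp_grp hdegree]

/-- The infinitesimal element. -/
def eps : KappaExt hcocycle hdegree := ⟨0, 1⟩

theorem eps_mul (x : KappaExt hcocycle hdegree) :
    eps hcocycle hdegree * x = ⟨0, x.fst⟩ := by
  ext1
  · simp only [eps, SquareZero.fst_mul, zero_mul]
  · simp only [eps, SquareZero.snd_mul, zero_mul, one_mul, map_zero, LinearMap.zero_apply, zero_add,
      add_zero]

theorem mul_eps (x : KappaExt hcocycle hdegree) :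
    x * eps hcocycle hdegree = ⟨0, x.fst⟩ := by
  ext1
  · simp only [eps, SquareZero.fst_mul, mul_zero]
  · simp only [eps, SquareZero.snd_mul, mul_zero, mul_one, map_zero, add_zero]

theorem grpHom_mul_vecHom (g : G) (v : V) : grpHom hcocycle hdegree g * vecHom hcocycle hdegree v =
    vecHom hcocycle hdegree (g • v) * grpHom hcocycle hdegree g := by
  ext1
  · exact Skew.grp_mul_vec g v
  · change Skew.grp k V g * 0 + 0 * vec k G v + κ (Skew.grp k V g) (vec k G v) =
      vec k G (g • v) * 0 + 0 * Skew.grp k V g + κ (vec k G (g • v)) (Skew.grp k V g)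
    rw [cocycle_grp_vec hdegree, cocycle_vec_grp hdegree, mul_zero, mul_zero, zero_mul, zero_mul]

omit hcocycle hdegree in
theorem vec_mul_vec_comm (v w : V) : vec k G v * vec k G w = vec k G w * vec k G v := by
  rw [vec, vec, SkewMonoidAlgebra.single_mul_single, SkewMonoidAlgebra.single_mul_single, one_smul,
    one_smul, mul_comm]

theorem vecHom_mul_vecHom_sub (v w : V) :
    vecHom hcocycle hdegree v * vecHom hcocycle hdegree w -
      vecHom hcocycle hdegree w * vecHom hcocycle hdegree v =
        ⟨0, groupIncl k G V (vectorForm κ v w)⟩ := by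
  ext1
  · change vec k G v * vec k G w - vec k G w * vec k G v = 0
    rw [vec_mul_vec_comm, sub_self]
  · change (vec k G v * 0 + 0 * vec k G w + κ (vec k G v) (vec k G w)) -
      (vec k G w * 0 + 0 * vec k G v + κ (vec k G w) (vec k G v)) = _
    rw [groupIncl_vectorForm hdegree, mul_zero, mul_zero, zero_mul, zero_mul, add_zero, zero_add,
      zero_add]

theorem fst_lift (x : MonoidAlgebra k G) :
    (MonoidAlgebra.lift k _ G (grpHom hcocycle hdegree) x).fst = groupIncl k G V x := by
  induction x using MonoidAlgebra.induction_linear with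
  | zero => rw [map_zero, map_zero]; rfl
  | add x y hx hy => rw [map_add, map_add, SquareZero.fst_add, hx, hy]
  | single g c =>
    rw [MonoidAlgebra.lift_single, groupIncl, MonoidAlgebra.lift_single]; rfl

omit hcocycle hdegree in
theorem mul_mk_zero {hcocycle : IsHochschildTwoCocycle κ} {hdegree : IsHomogeneousOfDegree κ (-2)}
    (x : KappaExt hcocycle hdegree) (y : Skew k G V) :
    x * ⟨0, y⟩ = (⟨0, x.fst * y⟩ : KappaExt hcocycle hdegree) := by
  ext1
  · simp only [SquareZero.fst_mul, mul_zero]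
  · simp only [SquareZero.snd_mul, mul_zero, map_zero, add_zero]

omit hcocycle hdegree in
theorem mk_zero_mul {hcocycle : IsHochschildTwoCocycle κ} {hdegree : IsHomogeneousOfDegree κ (-2)}
    (x : KappaExt hcocycle hdegree) (y : Skew k G V) :
    ⟨0, y⟩ * x = (⟨0, y * x.fst⟩ : KappaExt hcocycle hdegree) := by
  ext1
  · simp only [SquareZero.fst_mul, zero_mul]
  · simp only [SquareZero.snd_mul, zero_mul, map_zero, LinearMap.zero_apply, zero_add, add_zero]

end KappaExt

/-- The ε-component of moving g past the commutator of two lifted vectors in the square-zero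
extension. -/
theorem grp_mul_groupIncl_vectorForm (g : G) (v w : V) :
    Skew.grp k V g * groupIncl k G V (vectorForm κ v w) =
      groupIncl k G V (vectorForm κ (g • v) (g • w)) * Skew.grp k V g := by
  have h : KappaExt.grpHom hcocycle hdegree g * (KappaExt.vecHom hcocycle hdegree v *
      KappaExt.vecHom hcocycle hdegree w - KappaExt.vecHom hcocycle hdegree w *
        KappaExt.vecHom hcocycle hdegree v) =
      (KappaExt.vecHom hcocycle hdegree (g • v) *
      KappaExt.vecHom hcocycle hdegree (g • w) - KappaExt.vecHom hcocycle hdegree (g • w) *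
        KappaExt.vecHom hcocycle hdegree (g • v)) * KappaExt.grpHom hcocycle hdegree g := by
    rw [mul_sub, sub_mul, ← mul_assoc, KappaExt.grpHom_mul_vecHom, mul_assoc,
      KappaExt.grpHom_mul_vecHom, ← mul_assoc, ← mul_assoc, KappaExt.grpHom_mul_vecHom,
      mul_assoc _ (KappaExt.grpHom hcocycle hdegree g), KappaExt.grpHom_mul_vecHom, ← mul_assoc]
  rw [KappaExt.vecHom_mul_vecHom_sub, KappaExt.vecHom_mul_vecHom_sub, KappaExt.mul_mk_zero,
    KappaExt.mk_zero_mul] at h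
  exact congrArg SquareZero.snd h

/-- The ε-component of the Jacobi identity for commutators in the associative square-zero extension.
-/
theorem jacobi_groupIncl_vectorForm (u v w : V) :
    (vec k G u * groupIncl k G V (vectorForm κ v w) - groupIncl k G V (vectorForm κ v w) * vec k G u)
    + (vec k G v * groupIncl k G V (vectorForm κ w u)
        - groupIncl k G V (vectorForm κ w u) * vec k G v)
    + (vec k G w * groupIncl k G V (vectorForm κ u v)
        - groupIncl k G V (vectorForm κ u v) * vec k G w) = 0 := by
  have h : ∀ x y z : KappaExt hcocycle hdegree,
      (x * (y * z - z * y) - (y * z - z * y) * x) + (y * (z * x - x * z) - (z * x - x * z) * y)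
        + (z * (x * y - y * x) - (x * y - y * x) * z) = 0 := fun x y z => by noncomm_ring
  have h1 := h (KappaExt.vecHom hcocycle hdegree u) (KappaExt.vecHom hcocycle hdegree v)
    (KappaExt.vecHom hcocycle hdegree w)
  simp only [KappaExt.vecHom_mul_vecHom_sub, KappaExt.mul_mk_zero, KappaExt.mk_zero_mul] at h1
  exact congrArg SquareZero.snd h1

theorem isPBWForm_vectorForm : IsPBWForm (vectorForm κ) where
  alt := vectorForm_self
  equivariant g v w := by
    apply Skew.groupIncl_injective (V := V)
    rw [map_mul, map_mul, Skew.groupIncl_single]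
    exact grp_mul_groupIncl_vectorForm hcocycle hdegree g v w
  jacobi g u v w := by
    apply symmetricAlgebra_ι_injective (k := k)
    rw [map_add, map_add, ← Skew.coeff_vec_commutator, ← Skew.coeff_vec_commutator,
      ← Skew.coeff_vec_commutator, map_zero]
    have h := congrArg (fun x => SkewMonoidAlgebra.coeff x g)
      (jacobi_groupIncl_vectorForm hcocycle hdegree u v w)
    simpa only [SkewMonoidAlgebra.coeff_add, SkewMonoidAlgebra.coeff_sub, Finsupp.add_apply,
      Finsupp.sub_apply, SkewMonoidAlgebra.coeff_zero, Finsupp.zero_apply] using h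

end KappaZero

end SkewGroupDeformation

end

noncomputable section

namespace SkewGroupDeformation

open Polynomial

section Homogenization

variable {k : Type*} {G : Type*} {V : Type*} [Field k] [Group G] [AddCommGroup V] [Module k V]
  [DistribMulAction G V] [SMulCommClass G k V]

/-! ### Adjoining a central parameter -/

/-- The action of `G × ℕ` on `V` through `G`. -/
instance prodDistribMulAction : DistribMulAction (G × Multiplicative ℕ) V :=
  DistribMulAction.compHom V (MonoidHom.fst G (Multiplicative ℕ))

theorem prod_smul_def (g : G × Multiplicative ℕ) (v : V) : g • v = g.1 • v := rfl

instance prodSMulCommClass : SMulCommClass (G × Multiplicative ℕ) k V where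
  smul_comm g c v := smul_comm g.1 c v

variable (k G) in
/-- The map `x ↦ x t` from `kG` to `k[G × ℕ] = kG[t]`. -/
def shift : MonoidAlgebra k G →ₗ[k] MonoidAlgebra k (G × Multiplicative ℕ) :=
  MonoidAlgebra.mapDomainLinearMap k k fun g => (g, Multiplicative.ofAdd 1)

omit [Group G] in
theorem shift_single (g : G) (c : k) : shift k G (MonoidAlgebra.single g c) =
    MonoidAlgebra.single (g, Multiplicative.ofAdd 1) c :=
  MonoidAlgebra.mapDomainLinearMap_single ..

omit [Group G] in
theorem coeff_shift (x : MonoidAlgebra k G) (g : G × Multiplicative ℕ) :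
    (shift k G x).coeff g = if g.2 = Multiplicative.ofAdd 1 then x.coeff g.1 else 0 := by
  classical
  induction x using MonoidAlgebra.induction_linear with
  | zero => simp
  | add x y hx hy =>
    rw [map_add, MonoidAlgebra.coeff_add, Finsupp.add_apply, hx, hy, MonoidAlgebra.coeff_add,
      Finsupp.add_apply]
    split_ifs <;> simp
  | single h c =>
    obtain ⟨g, n⟩ := g
    rw [shift_single, MonoidAlgebra.coeff_single, MonoidAlgebra.coeff_single, Finsupp.single_apply,
      Finsupp.single_apply]
    simp only [Prod.mk_inj]
    grind

theorem single_mul_shift (g : G) (n : Multiplicative ℕ) (x : MonoidAlgebra k G) :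
    MonoidAlgebra.single (g, n) 1 * shift k G x =
      MonoidAlgebra.single (1, n) 1 * shift k G (MonoidAlgebra.single g 1 * x) := by
  induction x using MonoidAlgebra.induction_linear with
  | zero => simp
  | add x y hx hy => rw [map_add, mul_add, hx, hy, mul_add, map_add, mul_add]
  | single h c => simp [shift_single, MonoidAlgebra.single_mul_single]

theorem shift_mul_single (g : G) (n : Multiplicative ℕ) (x : MonoidAlgebra k G) :
    shift k G x * MonoidAlgebra.single (g, n) 1 =
      MonoidAlgebra.single (1, n) 1 * shift k G (x * MonoidAlgebra.single g 1) := by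
  induction x using MonoidAlgebra.induction_linear with
  | zero => simp
  | add x y hx hy => rw [map_add, add_mul, hx, hy, add_mul, map_add, mul_add]
  | single h c => simp [shift_single, MonoidAlgebra.single_mul_single, mul_comm]

/-- The form `κ t` with values in `kG[t]`. -/
def shiftForm (κ : V →ₗ[k] V →ₗ[k] MonoidAlgebra k G) :
    V →ₗ[k] V →ₗ[k] MonoidAlgebra k (G × Multiplicative ℕ) :=
  κ.compr₂ (shift k G)

omit [DistribMulAction G V] [SMulCommClass G k V] [Group G] in
theorem shiftForm_apply (κ : V →ₗ[k] V →ₗ[k] MonoidAlgebra k G) (v w : V) :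
    shiftForm κ v w = shift k G (κ v w) := rfl

-- The parameter acts trivially on V and commutes with G, and the shifted form is supported at its
-- first power, so each condition reduces to the one for κ.
omit [SMulCommClass G k V] in
theorem IsPBWForm.shiftForm {κ : V →ₗ[k] V →ₗ[k] MonoidAlgebra k G} (hκ : IsPBWForm κ) :
    IsPBWForm (shiftForm κ) where
  alt v := by rw [shiftForm_apply, hκ.alt, map_zero]
  equivariant g v w := by
    rw [shiftForm_apply, shiftForm_apply, ← Prod.mk.eta (p := g), single_mul_shift,
      shift_mul_single, hκ.equivariant]
    rfl
  jacobi g u v w := by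
    simp only [shiftForm_apply, coeff_shift, prod_smul_def]
    split_ifs
    · exact hκ.jacobi g.1 u v w
    · simp

/-- The algebra with a central parameter `t` and the relations `v w - w v = κ(v, w) t`. -/
abbrev ParamQuotient (κ : V →ₗ[k] V →ₗ[k] MonoidAlgebra k G) : Type _ := SkewQuotient (shiftForm κ)

namespace ParamQuotient

variable (κ : V →ₗ[k] V →ₗ[k] MonoidAlgebra k G)

/-- The image of `G`. -/
def grp : G →* ParamQuotient κ := (SkewQuotient.grp (shiftForm κ)).comp (MonoidHom.inl _ _)

/-- The central parameter. -/
def param : ParamQuotient κ := SkewQuotient.grp (shiftForm κ) (1, Multiplicative.ofAdd 1)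

theorem param_pow (n : ℕ) :
    param κ ^ n = SkewQuotient.grp (shiftForm κ) (1, Multiplicative.ofAdd n) := by
  rw [param, ← map_pow, Prod.pow_mk, one_pow, ← ofAdd_nsmul, smul_eq_mul, mul_one]

theorem grp_mul_param_pow (g : G) (n : ℕ) : grp κ g * param κ ^ n =
    SkewQuotient.grp (shiftForm κ) (g, Multiplicative.ofAdd n) := by
  rw [param_pow, grp, MonoidHom.comp_apply, ← map_mul]
  simp

theorem param_commute (x : ParamQuotient κ) : Commute (param κ) x := by
  have hv : ∀ v, Commute (param κ) (SkewQuotient.vec (shiftForm κ) v) := fun v => by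
    rw [Commute, SemiconjBy, param, SkewQuotient.grp_mul_vec, prod_smul_def, one_smul]
  have hg : ∀ g, Commute (param κ) (SkewQuotient.grp (shiftForm κ) g) := fun g => by
    rw [Commute, SemiconjBy, param, ← map_mul, ← map_mul]
    congr 1
    ext1
    · rw [Prod.fst_mul, Prod.fst_mul, one_mul, mul_one]
    · exact mul_comm _ _
  obtain ⟨x, rfl⟩ := SkewQuotient.mk_surjective _ x
  -- The elements whose image commutes with t form a subalgebra containing the generators. The
  -- universal property gives a map F into it; followed by the inclusion this is the identity, so
  -- the subalgebra is everything.
  let S : Subalgebra k (TensorSkew k (G × Multiplicative ℕ) V) :=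
    (Subalgebra.centralizer k {param κ}).comap (SkewQuotient.mk (shiftForm κ))
  have hS : ∀ {y}, y ∈ S ↔ Commute (param κ) (SkewQuotient.mk (shiftForm κ) y) := by
    intro y
    simp only [S, Subalgebra.mem_comap, Subalgebra.mem_centralizer_iff, Set.mem_singleton_iff,
      forall_eq]
    rfl
  let φ : V →ₗ[k] S := (TensorSkew.vec k _).codRestrict (Subalgebra.toSubmodule S) fun v => hS.2 (hv v)
  let ψ : G × Multiplicative ℕ →* S := (TensorSkew.grp k V).codRestrict S fun g => hS.2 (hg g)
  have hcomm : ∀ g v, ψ g * φ v = φ (g • v) * ψ g :=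
    fun g v => Subtype.ext (TensorSkew.grp_mul_vec g v)
  let F : TensorSkew k (G × Multiplicative ℕ) V →ₐ[k] S := TensorSkew.lift φ ψ hcomm
  have h : S.val.comp F = AlgHom.id k _ := TensorSkew.hom_ext
    (fun v => congrArg Subtype.val (TensorSkew.lift_vec _ _ hcomm v))
    (fun g => congrArg Subtype.val (TensorSkew.lift_grp _ _ hcomm g))
  have hx := (F x).2
  rw [← S.val_apply, ← AlgHom.comp_apply, h] at hx
  exact hS.1 hx

theorem vec_mul_vec_sub (v w : V) :
    SkewQuotient.vec (shiftForm κ) v * SkewQuotient.vec (shiftForm κ) w -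
      SkewQuotient.vec (shiftForm κ) w * SkewQuotient.vec (shiftForm κ) v =
    param κ * MonoidAlgebra.lift k _ G (grp κ) (κ v w) := by
  rw [SkewQuotient.vec_mul_vec_sub, shiftForm_apply]
  induction κ v w using MonoidAlgebra.induction_linear with
  | zero => simp
  | add x y hx hy => rw [map_add, map_add, map_add, mul_add, hx, hy]
  | single h c =>
    rw [shift_single, MonoidAlgebra.lift_single, MonoidAlgebra.lift_single, mul_smul_comm,
      (param_commute κ _).eq, ← pow_one (param κ), grp_mul_param_pow]

end ParamQuotient

end Homogenization

end SkewGroupDeformation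

end

noncomputable section

namespace SkewGroupDeformation

open Polynomial

section Transport

variable {k A H : Type*} [Field k] [Ring A] [Algebra k A] [Ring H] [Algebra k H] [Algebra k[X] H]
  [IsScalarTower k k[X] H]

/-! ### Transporting the product of a `k[t]`-algebra to `A[t]` -/

/-- The `k[t]`-linear extension to `A[t]` of a linear map on `A`. -/
def polyExtend (s : A →ₗ[k] H) : PolynomialModule k A →ₗ[k[X]] H where
  toFun p := p.coeff.sum fun n a => (X ^ n : k[X]) • s a
  map_add' p q := by
    rw [PolynomialModule.coeff_add]
    exact Finsupp.sum_add_index' (fun n => by simp) (fun n a b => by simp)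
  map_smul' c p := by
    have hadd : ∀ p q : PolynomialModule k A,
        ((p + q).coeff.sum fun n a => (X ^ n : k[X]) • s a) =
          (p.coeff.sum fun n a => (X ^ n : k[X]) • s a) +
            q.coeff.sum fun n a => (X ^ n : k[X]) • s a := fun p q => by
      rw [PolynomialModule.coeff_add]
      exact Finsupp.sum_add_index' (fun n => by simp) (fun n a b => by simp)
    have hsingle : ∀ n a, ((PolynomialModule.single k n a).coeff.sum
        fun n a => (X ^ n : k[X]) • s a) = (X ^ n : k[X]) • s a := fun n a => by simp
    simp only [RingHom.id_apply]
    induction p using PolynomialModule.induction_linear with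
    | zero => simp
    | add p q hp hq => rw [smul_add, hadd, hp, hq, hadd, smul_add]
    | single n a =>
      induction c using Polynomial.induction_on' with
      | add c c' hc hc' => rw [add_smul, hadd, hc, hc', add_smul]
      | monomial m r =>
        rw [PolynomialModule.monomial_smul_single, hsingle, hsingle, map_smul, ← C_mul_X_pow_eq_monomial,
          ← smul_eq_C_mul, smul_assoc, smul_smul, ← pow_add, smul_comm]

theorem polyExtend_single (s : A →ₗ[k] H) (n : ℕ) (a : A) :
    polyExtend s (PolynomialModule.single k n a) = (X ^ n : k[X]) • s a := by
  simp [polyExtend]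

/-- Every element of `A[t]` is determined by its image in `H`, if every element is so modulo
terms of higher order in `t`. -/
theorem polyExtend_bijective (s : A →ₗ[k] H) (hs : Function.Bijective (polyExtend s))
    (f : A →ₗ[k] A) (P : ℕ → Submodule k A) (hP : ⨆ n, P n = ⊤)
    (hf : ∀ n, ∀ a ∈ P n, f a = 0 ∨ ∃ m < n, f a ∈ P m) (s' : A →ₗ[k] H)
    (hs' : ∀ a, s' a = s a - (X : k[X]) • s (f a)) : Function.Bijective (polyExtend s') := by
  -- F = 1 − t f, and the extension of s' is that of s composed with F, so it suffices that F is
  -- bijective.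
  let F : PolynomialModule k A →ₗ[k] PolynomialModule k A :=
    LinearMap.id - (DistribSMul.toLinearMap k _ (X : k[X])) ∘ₗ PolynomialModule.map k f
  have hF : ∀ p, polyExtend s' p = polyExtend s (F p) := by
    intro p
    induction p using PolynomialModule.induction_linear with
    | zero => simp
    | add p q hp hq => rw [map_add, map_add, hp, hq, map_add]
    | single n a =>
      simp only [F, LinearMap.sub_apply, LinearMap.comp_apply, PolynomialModule.map_single,
        DistribSMul.toLinearMap_apply, map_sub, map_smul, polyExtend_single, LinearMap.id_apply, hs',
        smul_sub, smul_smul, ← pow_succ, ← pow_succ']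
  have hcoeff : ∀ p n, (PolynomialModule.map k f p).coeff n = f (p.coeff n) := by
    intro p n
    induction p using PolynomialModule.induction_linear with
    | zero => simp
    | add p q hp hq => simp [hp, hq]
    | single m a => simp [Finsupp.single_apply, apply_ite f]
  constructor
  -- If p = t f(p), the constant coefficient of p vanishes, and then each further coefficient in
  -- turn.
  · rw [injective_iff_map_eq_zero]
    intro p hp
    rw [hF, map_eq_zero_iff _ hs.1, LinearMap.sub_apply, sub_eq_zero] at hp
    ext n
    have h1 : ∀ n, p.coeff n = if 1 ≤ n then f (p.coeff (n - 1)) else 0 := by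
      intro n
      have h1 := congrArg (fun q => q.coeff n) hp
      simp only [LinearMap.id_apply, LinearMap.comp_apply, DistribSMul.toLinearMap_apply] at h1
      rwa [← pow_one (X : k[X]), ← monomial_one_right_eq_X_pow,
        PolynomialModule.monomial_smul_apply, one_smul, hcoeff] at h1
    change p.coeff n = 0
    induction n with
    | zero => rw [h1, if_neg (by omega)]
    | succ n ih => rw [h1, if_pos (by omega), Nat.add_sub_cancel, ih, map_zero]
  -- The geometric series for (1 − t f)⁻¹: a tⁱ = F(a tⁱ) + f(a) tⁱ⁺¹, which stops because f lowers
  -- the index of `P`.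
  · have h : ∀ n, ∀ a ∈ P n, ∀ i, PolynomialModule.single k i a ∈ LinearMap.range F := by
      intro n
      induction n using Nat.strong_induction_on with
      | _ n ih =>
      intro a ha i
      have h1 : PolynomialModule.single k i a = F (PolynomialModule.single k i a) +
          PolynomialModule.single k (1 + i) (f a) := by
        simp only [F, LinearMap.sub_apply, LinearMap.comp_apply, PolynomialModule.map_single,
          DistribSMul.toLinearMap_apply, LinearMap.id_apply]
        rw [← pow_one (X : k[X]), ← monomial_one_right_eq_X_pow,
          PolynomialModule.monomial_smul_single, one_smul, sub_add_cancel]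
      rw [h1]
      refine add_mem ⟨_, rfl⟩ ?_
      obtain h0 | ⟨m, hm, h0⟩ := hf n a ha
      · rw [h0, PolynomialModule.single_zero]; exact zero_mem _
      · exact ih m hm _ h0 _
    have h2 : ∀ i a, PolynomialModule.single k i a ∈ LinearMap.range F := by
      intro i a
      have ha : a ∈ ⨆ n, P n := hP ▸ Submodule.mem_top
      have h3 : ⨆ n, P n ≤ (LinearMap.range F).comap (PolynomialModule.lsingle k i) :=
        iSup_le fun n a ha => h n a ha i
      exact h3 ha
    intro y
    obtain ⟨q, rfl⟩ := hs.2 y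
    have hq : q ∈ LinearMap.range F := by
      induction q using PolynomialModule.induction_linear with
      | zero => exact zero_mem _
      | add p q hp hq => exact add_mem hp hq
      | single i a => exact h2 i a
    obtain ⟨p, rfl⟩ := hq
    exact ⟨p, hF p⟩

/-- If s lifts A without ε-term and t acts as ε, then the composite from A[t] to the extension is
reduction modulo t²; higher powers die because ε² = 0. -/
theorem map_polyExtend {μ : A →ₗ[k] A →ₗ[k] A} {hμ : IsHochschildTwoCocycle μ} {h1 : μ 1 1 = 0}
    (π : H →ₐ[k] SquareZero μ hμ h1) (hX : ∀ x, π ((X : k[X]) • x) = ⟨0, (π x).fst⟩)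
    (s : A →ₗ[k] H) (hs : ∀ a, π (s a) = ⟨a, 0⟩) (p : PolynomialModule k A) :
    π (polyExtend s p) = ⟨p.coeff 0, p.coeff 1⟩ := by
  induction p using PolynomialModule.induction_linear with
  | zero => rw [map_zero, map_zero]; rfl
  | add p q hp hq => rw [map_add, map_add, hp, hq]; rfl
  | single n a =>
    rw [polyExtend_single]
    match n with
    | 0 => simp [hs]
    | 1 => simp [hs, hX]
    | n + 2 =>
      rw [pow_succ', pow_succ', mul_smul, mul_smul, hX, hX]
      simp

namespace Deformation

/-- The deformation of `A` obtained from a `k[t]`-algebra which is isomorphic to `A[t]` as a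
module. -/
def ofEquiv (e : PolynomialModule k A ≃ₗ[k[X]] H) (hone : e (PolynomialModule.single k 0 1) = 1)
    (hmul : ∀ a b, (e.symm (e (PolynomialModule.single k 0 a) *
      e (PolynomialModule.single k 0 b))).coeff 0 = a * b) : Deformation k A where
  mul := LinearMap.mk₂ k[X] (fun p q => e.symm (e p * e q))
    (fun p p' q => by rw [map_add, add_mul, map_add])
    (fun c p q => by rw [map_smul, smul_mul_assoc, map_smul])
    (fun p q q' => by rw [map_add, mul_add, map_add])
    (fun c p q => by rw [map_smul, mul_smul_comm, map_smul])
  mul_assoc p q r := by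
    simp only [LinearMap.mk₂_apply, LinearEquiv.apply_symm_apply, _root_.mul_assoc]
  one_mul p := by
    simp only [LinearMap.mk₂_apply, hone, _root_.one_mul, LinearEquiv.symm_apply_apply]
  mul_one p := by
    simp only [LinearMap.mk₂_apply, hone, _root_.mul_one, LinearEquiv.symm_apply_apply]
  coeff_zero := hmul

/-- The deformed algebra is isomorphic to the given `k[t]`-algebra. -/
def totalEquiv (e : PolynomialModule k A ≃ₗ[k[X]] H)
    (hone : e (PolynomialModule.single k 0 1) = 1)
    (hmul : ∀ a b, (e.symm (e (PolynomialModule.single k 0 a) *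
      e (PolynomialModule.single k 0 b))).coeff 0 = a * b) :
    (ofEquiv e hone hmul).Total ≃ₐ[k[X]] H :=
  AlgEquiv.ofLinearEquiv (e : (ofEquiv e hone hmul).Total ≃ₗ[k[X]] H) hone
    fun p q => e.apply_symm_apply (e p * e q)

end Deformation

end Transport

end SkewGroupDeformation

end

/-! ### H_t as a k[t]-module, and its map to the square-zero extension -/

noncomputable section

namespace SkewGroupDeformation

open Polynomial

section Transport

variable {k A H : Type*} [Field k] [Ring A] [Algebra k A] [Ring H] [Algebra k H] [Algebra k[X] H]
  [IsScalarTower k k[X] H]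

theorem polyExtend_bijective_of_basis {I J : Type*} (bA : Module.Basis I k A)
    (bH : Module.Basis J k H) (e : (Σ _ : ℕ, I) ≃ J) (s : A →ₗ[k] H)
    (h : ∀ n i, (X ^ n : k[X]) • s (bA i) = bH (e ⟨n, i⟩)) : Function.Bijective (polyExtend s) := by
  let B : Module.Basis (Σ _ : ℕ, I) k (PolynomialModule k A) :=
    (Finsupp.basis fun _ : ℕ => bA).map (PolynomialModule.coeffLinearEquiv k k).symm
  have hB : ∀ n i, B ⟨n, i⟩ = PolynomialModule.single k n (bA i) := fun n i => by
    simp [B]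
  have h1 : (polyExtend s).restrictScalars k = (B.equiv bH e).toLinearMap := by
    refine B.ext fun ⟨n, i⟩ => ?_
    rw [LinearMap.restrictScalars_apply, hB, polyExtend_single, h, ← hB, LinearEquiv.coe_coe,
      Module.Basis.equiv_apply]
  have h2 : ⇑(polyExtend s) = B.equiv bH e := funext fun x => DFunLike.congr_fun h1 x
  rw [h2]
  exact (B.equiv bH e).bijective

variable (k A) in
/-- The coefficient of `ε`. -/
def SquareZero.sndHom (μ : A →ₗ[k] A →ₗ[k] A) (hμ : IsHochschildTwoCocycle μ) (h1 : μ 1 1 = 0) :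
    SquareZero μ hμ h1 →ₗ[k] A where
  toFun := SquareZero.snd
  map_add' _ _ := rfl
  map_smul' _ _ := rfl

end Transport

section Homogenization

variable {k : Type*} {G : Type*} {V : Type*} [Field k] [Group G] [AddCommGroup V] [Module k V]
  [DistribMulAction G V] [SMulCommClass G k V]

namespace ParamQuotient

section

variable (κ : V →ₗ[k] V →ₗ[k] MonoidAlgebra k G)

instance : Algebra k[X] (ParamQuotient κ) :=
  (aeval (param κ)).toRingHom.toAlgebra' fun c x => by
    change Commute (aeval (param κ) c) x
    induction c using Polynomial.induction_on' with
    | add p q hp hq => rw [map_add]; exact hp.add_left hq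
    | monomial n r =>
      rw [aeval_monomial]
      exact Commute.mul_left (Algebra.commutes r x) ((param_commute κ x).pow_left n)

theorem algebraMap_eq (c : k[X]) : algebraMap k[X] (ParamQuotient κ) c = aeval (param κ) c := rfl

instance : IsScalarTower k k[X] (ParamQuotient κ) :=
  IsScalarTower.of_algebraMap_eq fun c => by
    rw [algebraMap_eq, ← C_eq_algebraMap, aeval_C]

theorem X_pow_smul (n : ℕ) (x : ParamQuotient κ) : (X ^ n : k[X]) • x = param κ ^ n * x := by
  rw [Algebra.smul_def, algebraMap_eq, map_pow, aeval_X]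

theorem X_smul (x : ParamQuotient κ) : (X : k[X]) • x = param κ * x := by
  rw [Algebra.smul_def, algebraMap_eq, aeval_X]

variable {d : ℕ} (b : Module.Basis (Fin d) k V)

/-- The linear map from `S(V) # G` which sends sorted words to words. -/
def ofSkew : Skew k G V →ₗ[k] ParamQuotient κ :=
  (Skew.basis b).constr k fun x => SkewQuotient.word b x.1.sort (x.2, 1)

theorem ofSkew_basis (x : Multiset (Fin d) × G) :
    ofSkew κ b (Skew.basis b x) = SkewQuotient.word b x.1.sort (x.2, 1) := by
  rw [ofSkew, Module.Basis.constr_basis]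

theorem ofSkew_grp (g : G) : ofSkew κ b (Skew.grp k V g) = grp κ g := by
  have h : Skew.grp k V g = Skew.basis b (0, g) := by
    rw [Skew.basis_apply, Multiset.sort_zero, Skew.word]; simp
  rw [h, ofSkew_basis, Multiset.sort_zero, SkewQuotient.word]
  simp [grp]

theorem ofSkew_vec (v : V) : ofSkew κ b (vec k G v) = SkewQuotient.vec (shiftForm κ) v := by
  have h : ofSkew κ b ∘ₗ Skew.vecHom k G V = SkewQuotient.vec (shiftForm κ) := by
    refine b.ext fun i => ?_
    have h : Skew.vecHom k G V (b i) = Skew.basis b ({i}, 1) := by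
      rw [Skew.basis_apply, Multiset.sort_singleton, Skew.word]; simp
    rw [LinearMap.comp_apply, h, ofSkew_basis, Multiset.sort_singleton, SkewQuotient.word]
    simp [← Prod.one_eq_mk]
  exact DFunLike.congr_fun h v

-- The PBW basis for G × ℕ consists of the elements tⁿ s(x), with x in the basis of S(V) # G. So H_t
-- is free over k[t] on the sorted words.
variable {κ} in
theorem polyExtend_ofSkew_bijective (hκ : IsPBWForm κ) :
    Function.Bijective (polyExtend (ofSkew κ b)) := by
  let e : (Σ _ : ℕ, Multiset (Fin d) × G) ≃ Multiset (Fin d) × (G × Multiplicative ℕ) :=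
    { toFun := fun x => (x.2.1, (x.2.2, Multiplicative.ofAdd x.1))
      invFun := fun x => ⟨x.2.2.toAdd, (x.1, x.2.1)⟩
      left_inv := fun _ => rfl
      right_inv := fun _ => rfl }
  refine polyExtend_bijective_of_basis (Skew.basis b) (SkewQuotient.pbwBasis b hκ.shiftForm) e _
    fun n ⟨m, g⟩ => ?_
  rw [ofSkew_basis, X_pow_smul, ((param_commute κ _).pow_left n).eq]
  change _ = SkewQuotient.pbwBasis b hκ.shiftForm (m, (g, Multiplicative.ofAdd n))
  rw [SkewQuotient.pbwBasis_apply, SkewQuotient.word, SkewQuotient.word, mul_assoc,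
    ← grp_mul_param_pow]
  rfl

end

section Cocycle

variable {κ : Skew k G V →ₗ[k] Skew k G V →ₗ[k] Skew k G V}
  (hcocycle : IsHochschildTwoCocycle κ) (hdegree : IsHomogeneousOfDegree κ (-2))

theorem eps_commute (x : KappaExt hcocycle hdegree) :
    Commute x (KappaExt.eps hcocycle hdegree) := by
  rw [Commute, SemiconjBy, KappaExt.eps_mul, KappaExt.mul_eps]

/-- The map from `G × ℕ` to the square-zero extension. -/
def extGrp : G × Multiplicative ℕ →* KappaExt hcocycle hdegree :=
  (KappaExt.grpHom hcocycle hdegree).noncommCoprod (powersHom _ (KappaExt.eps hcocycle hdegree))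
    fun g n => by
      rw [powersHom_apply]
      exact (eps_commute hcocycle hdegree _).pow_right _

theorem extGrp_apply (g : G) (n : ℕ) : extGrp hcocycle hdegree (g, Multiplicative.ofAdd n) =
    KappaExt.grpHom hcocycle hdegree g * KappaExt.eps hcocycle hdegree ^ n := rfl

theorem lift_extGrp_shift (x : MonoidAlgebra k G) :
    MonoidAlgebra.lift k _ _ (extGrp hcocycle hdegree) (shift k G x) =
      MonoidAlgebra.lift k _ _ (KappaExt.grpHom hcocycle hdegree) x *
        KappaExt.eps hcocycle hdegree := by
  induction x using MonoidAlgebra.induction_linear with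
  | zero => simp
  | add x y hx hy => rw [map_add, map_add, map_add, add_mul, hx, hy]
  | single g c =>
    rw [shift_single, MonoidAlgebra.lift_single, MonoidAlgebra.lift_single, extGrp_apply, pow_one,
      smul_mul_assoc]

/-- The map to the square-zero extension which sends `t` to `ε`. -/
def toExt : ParamQuotient (vectorForm κ) →ₐ[k] KappaExt hcocycle hdegree :=
  SkewQuotient.lift (KappaExt.vecHom hcocycle hdegree) (extGrp hcocycle hdegree)
    (fun ⟨g, n⟩ v => by
      rw [← ofAdd_toAdd n, extGrp_apply, mul_assoc,
        ← ((eps_commute hcocycle hdegree _).pow_right _).eq, ← mul_assoc,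
        KappaExt.grpHom_mul_vecHom, mul_assoc]
      rfl)
    fun v w => by
      rw [KappaExt.vecHom_mul_vecHom_sub, shiftForm_apply, lift_extGrp_shift, KappaExt.mul_eps,
        KappaExt.fst_lift]

theorem toExt_vec (v : V) : toExt hcocycle hdegree (SkewQuotient.vec _ v) =
    KappaExt.vecHom hcocycle hdegree v :=
  SkewQuotient.lift_vec _ _ _ _ v

theorem toExt_grp (g : G) : toExt hcocycle hdegree (grp _ g) =
    KappaExt.grpHom hcocycle hdegree g := by
  refine (SkewQuotient.lift_grp _ _ _ _ _).trans ?_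
  change extGrp hcocycle hdegree (g, Multiplicative.ofAdd 0) = _
  rw [extGrp_apply, pow_zero, mul_one]

theorem toExt_param : toExt hcocycle hdegree (param _) = KappaExt.eps hcocycle hdegree := by
  refine (SkewQuotient.lift_grp _ _ _ _ _).trans ?_
  rw [extGrp_apply, pow_one, map_one, one_mul]

theorem toExt_X_smul (x : ParamQuotient (vectorForm κ)) :
    toExt hcocycle hdegree ((X : k[X]) • x) = ⟨0, (toExt hcocycle hdegree x).fst⟩ := by
  rw [X_smul, map_mul, toExt_param, KappaExt.eps_mul]

end Cocycle

end ParamQuotient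

end Homogenization

end SkewGroupDeformation

end

/-! ### The corrected lift of S(V) # G and the deformation -/

noncomputable section

namespace SkewGroupDeformation

open Polynomial

section Degree

variable {k : Type*} {G : Type*} {V : Type*} [Field k] [Group G] [AddCommGroup V] [Module k V]
  [DistribMulAction G V] [SMulCommClass G k V]

theorem Skew.mul_mem_gradedPieceInt {m n : ℤ} {x y : Skew k G V} (hx : x ∈ gradedPieceInt k G V m)
    (hy : y ∈ gradedPieceInt k G V n) : x * y ∈ gradedPieceInt k G V (m + n) := by
  match m, n with
  | Int.ofNat m, Int.ofNat n => exact Skew.mul_mem_gradedPiece hx hy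
  | Int.negSucc m, n =>
    rw [show x = 0 from hx, zero_mul]
    exact zero_mem _
  | m, Int.negSucc n =>
    rw [show y = 0 from hy, mul_zero]
    exact zero_mem _

namespace KappaExt

variable {κ : Skew k G V →ₗ[k] Skew k G V →ₗ[k] Skew k G V}
  {hcocycle : IsHochschildTwoCocycle κ} {hdegree : IsHomogeneousOfDegree κ (-2)}

/-- The homogeneous elements of degree `n`, where `ε` has degree `2`. -/
def IsHomogeneous (n : ℕ) (x : KappaExt hcocycle hdegree) : Prop :=
  x.fst ∈ gradedPiece k G V n ∧ x.snd ∈ gradedPieceInt k G V (n - 2)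

/-- Giving ε degree 2 compensates the degree −2 of κ, so that the extension is graded. -/
theorem IsHomogeneous.mul {m n : ℕ} {x y : KappaExt hcocycle hdegree} (hx : IsHomogeneous m x)
    (hy : IsHomogeneous n y) : IsHomogeneous (m + n) (x * y) := by
  refine ⟨Skew.mul_mem_gradedPiece hx.1 hy.1, ?_⟩
  rw [SquareZero.snd_mul]
  refine add_mem (add_mem ?_ ?_) ?_
  · have h := Skew.mul_mem_gradedPieceInt (m := Int.ofNat m) hx.1 hy.2
    rwa [Int.ofNat_eq_natCast, show (m : ℤ) + ((n : ℤ) - 2) = (m + n : ℕ) - 2 by push_cast; ring] at h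
  · have h := Skew.mul_mem_gradedPieceInt (n := Int.ofNat n) hx.2 hy.1
    rwa [Int.ofNat_eq_natCast, show (m : ℤ) - 2 + (n : ℤ) = (m + n : ℕ) - 2 by push_cast; ring] at h
  · exact hdegree m n _ hx.1 _ hy.1

theorem isHomogeneous_vecHom (v : V) : IsHomogeneous 1 (vecHom hcocycle hdegree v) :=
  ⟨Skew.vec_mem_gradedPiece v, zero_mem _⟩

theorem isHomogeneous_grpHom (g : G) : IsHomogeneous 0 (grpHom hcocycle hdegree g) :=
  ⟨Skew.grp_mem_gradedPiece g, zero_mem _⟩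

variable {d : ℕ} (b : Module.Basis (Fin d) k V)

theorem isHomogeneous_word (w : List (Fin d)) (g : G) :
    IsHomogeneous w.length ((w.map fun i => vecHom hcocycle hdegree (b i)).prod *
      grpHom hcocycle hdegree g) := by
  induction w with
  | nil => simpa using isHomogeneous_grpHom g
  | cons i w ih =>
    rw [List.map_cons, List.prod_cons, mul_assoc, List.length_cons, add_comm]
    exact (isHomogeneous_vecHom _).mul ih

theorem fst_word (w : List (Fin d)) (g : G) :
    ((w.map fun i => vecHom hcocycle hdegree (b i)).prod * grpHom hcocycle hdegree g).fst =
      Skew.word b w g := by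
  rw [Skew.word]
  induction w with
  | nil => simp; rfl
  | cons i w ih =>
    rw [List.map_cons, List.prod_cons, mul_assoc, SquareZero.fst_mul, ih, List.map_cons,
      List.prod_cons, mul_assoc]
    rfl

end KappaExt

namespace ParamQuotient

variable {κ : Skew k G V →ₗ[k] Skew k G V →ₗ[k] Skew k G V}
  (hcocycle : IsHochschildTwoCocycle κ) (hdegree : IsHomogeneousOfDegree κ (-2))
  {d : ℕ} (b : Module.Basis (Fin d) k V)

theorem toExt_word (w : List (Fin d)) (g : G) :
    toExt hcocycle hdegree (SkewQuotient.word b w (g, 1)) =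
      (w.map fun i => KappaExt.vecHom hcocycle hdegree (b i)).prod *
        KappaExt.grpHom hcocycle hdegree g := by
  rw [SkewQuotient.word, map_mul, map_list_prod, List.map_map]
  congr 1
  · congr 2
    funext i
    exact toExt_vec hcocycle hdegree (b i)
  · exact toExt_grp hcocycle hdegree g

theorem fst_toExt_ofSkew (a : Skew k G V) : (toExt hcocycle hdegree (ofSkew _ b a)).fst = a := by
  have ha : a ∈ Submodule.span k (Set.range (Skew.basis (G := G) b)) := by
    rw [(Skew.basis b).span_eq]; trivial
  induction ha using Submodule.span_induction with
  | mem x hx =>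
    obtain ⟨⟨m, g⟩, rfl⟩ := hx
    rw [ofSkew_basis, toExt_word, KappaExt.fst_word, Skew.basis_apply]
  | zero => rw [map_zero, map_zero]; rfl
  | add x y _ _ hx hy => rw [map_add, map_add, SquareZero.fst_add, hx, hy]
  | smul c x _ hx => rw [map_smul, map_smul, SquareZero.fst_smul, hx]

/-- The coefficient of `ε` of the image of an element of `S(V) # G` in the square-zero
extension. -/
def correction : Skew k G V →ₗ[k] Skew k G V :=
  SquareZero.sndHom k _ κ hcocycle (cocycle_one_one hdegree) ∘ₗ
    (toExt hcocycle hdegree).toLinearMap ∘ₗ ofSkew _ b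

theorem toExt_ofSkew (a : Skew k G V) :
    toExt hcocycle hdegree (ofSkew _ b a) = ⟨a, correction hcocycle hdegree b a⟩ :=
  SquareZero.ext (fst_toExt_ofSkew hcocycle hdegree b a) rfl

/-- A word of length n maps to a product of n lifted vectors and a group element, which is
homogeneous of degree n with ε in degree 2. -/
theorem correction_mem {n : ℕ} {a : Skew k G V} (ha : a ∈ gradedPiece k G V n) :
    correction hcocycle hdegree b a ∈ gradedPieceInt k G V (n - 2) := by
  rw [Skew.gradedPiece_eq_span b] at ha
  induction ha using Submodule.span_induction with
  | mem x hx =>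
    obtain ⟨⟨m, g⟩, hm, rfl⟩ := hx
    have h := congrArg SquareZero.snd (toExt_ofSkew hcocycle hdegree b (Skew.basis b (m, g)))
    rw [ofSkew_basis, toExt_word] at h
    change SquareZero.snd _ = correction hcocycle hdegree b _ at h
    rw [← h]
    have h1 := (KappaExt.isHomogeneous_word (hcocycle := hcocycle) (hdegree := hdegree) b m.sort g).2
    rwa [Multiset.length_sort, show m.card = n from hm] at h1
  | zero => rw [map_zero]; exact zero_mem _
  | add x y _ _ hx hy => rw [map_add]; exact add_mem hx hy
  | smul c x _ hx => rw [map_smul]; exact Submodule.smul_mem _ c hx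

/-- The local nilpotence required by `polyExtend_bijective`. In degrees 0 and 1 the target has
negative degree. -/
theorem correction_eq_zero_or_mem (n : ℕ) (a : Skew k G V) (ha : a ∈ gradedPiece k G V n) :
    correction hcocycle hdegree b a = 0 ∨
      ∃ m < n, correction hcocycle hdegree b a ∈ gradedPiece k G V m := by
  have h := correction_mem hcocycle hdegree b ha
  match n with
  | 0 => exact Or.inl h
  | 1 => exact Or.inl h
  | n + 2 =>
    refine Or.inr ⟨n, by omega, ?_⟩
    rwa [Nat.cast_add, Nat.cast_ofNat, add_sub_cancel_right] at h

include b in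
theorem iSup_gradedPiece : ⨆ n, gradedPiece k G V n = ⊤ := by
  rw [eq_top_iff, ← (Skew.basis (G := G) b).span_eq, Submodule.span_le]
  rintro _ ⟨x, rfl⟩
  refine Submodule.mem_iSup_of_mem x.1.card ?_
  rw [Skew.gradedPiece_eq_span b]
  exact Submodule.subset_span ⟨x, rfl, rfl⟩

/-- The correction of `ofSkew` to a linear map whose values have no term in `ε` in the square-zero
extension. -/
def expansion : Skew k G V →ₗ[k] ParamQuotient (vectorForm κ) :=
  ofSkew _ b - DistribSMul.toLinearMap k _ (X : k[X]) ∘ₗ ofSkew _ b ∘ₗ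
    correction hcocycle hdegree b

theorem expansion_apply (a : Skew k G V) : expansion hcocycle hdegree b a =
    ofSkew _ b a - (X : k[X]) • ofSkew _ b (correction hcocycle hdegree b a) := rfl

theorem toExt_expansion (a : Skew k G V) :
    toExt hcocycle hdegree (expansion hcocycle hdegree b a) = ⟨a, 0⟩ := by
  rw [expansion_apply, map_sub, toExt_X_smul, toExt_ofSkew, toExt_ofSkew]
  ext1
  · rw [SquareZero.fst_sub, sub_zero]
  · rw [SquareZero.snd_sub, sub_self]

/-- A vector already lifts without ε-term, so its correction is zero. This keeps the final
isomorphism the identity on generators; the same holds for group elements. -/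
theorem expansion_vec (v : V) :
    expansion hcocycle hdegree b (vec k G v) = SkewQuotient.vec _ v := by
  have h := toExt_ofSkew hcocycle hdegree b (vec k G v)
  rw [ofSkew_vec, toExt_vec] at h
  have h1 : 0 = correction hcocycle hdegree b (vec k G v) := congrArg SquareZero.snd h
  rw [expansion_apply, ← h1, map_zero, smul_zero, sub_zero, ofSkew_vec]

theorem expansion_grp (g : G) :
    expansion hcocycle hdegree b (Skew.grp k V g) = grp _ g := by
  have h := toExt_ofSkew hcocycle hdegree b (Skew.grp k V g)
  rw [ofSkew_grp, toExt_grp] at h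
  have h1 : 0 = correction hcocycle hdegree b (Skew.grp k V g) := congrArg SquareZero.snd h
  rw [expansion_apply, ← h1, map_zero, smul_zero, sub_zero, ofSkew_grp]

theorem expansion_one : expansion hcocycle hdegree b 1 = 1 := by
  have h := expansion_grp hcocycle hdegree b 1
  rwa [map_one (Skew.grp k V), map_one (grp _)] at h

theorem polyExtend_expansion_bijective :
    Function.Bijective (polyExtend (expansion hcocycle hdegree b)) :=
  polyExtend_bijective _ (polyExtend_ofSkew_bijective b (isPBWForm_vectorForm hcocycle hdegree))
    (correction hcocycle hdegree b) (gradedPiece k G V) (iSup_gradedPiece b)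
    (correction_eq_zero_or_mem hcocycle hdegree b) _ (expansion_apply hcocycle hdegree b)

/-- The isomorphism of `A[t]` with the algebra with a central parameter. -/
def polyEquiv : PolynomialModule k (Skew k G V) ≃ₗ[k[X]] ParamQuotient (vectorForm κ) :=
  LinearEquiv.ofBijective _ (polyExtend_expansion_bijective hcocycle hdegree b)

theorem polyEquiv_single (a : Skew k G V) :
    polyEquiv hcocycle hdegree b (PolynomialModule.single k 0 a) =
      expansion hcocycle hdegree b a := by
  change polyExtend _ _ = _
  rw [polyExtend_single, pow_zero, one_smul]

/-- Reduction modulo t² is multiplicative, and a, c lift to (a, 0), (c, 0), whose product in the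
extension is (ac, κ(a, c)). The two components give the deformation condition and μ₁ = κ together.
-/
theorem coeff_polyEquiv_symm (a c : Skew k G V) :
    (⟨((polyEquiv hcocycle hdegree b).symm
        (polyEquiv hcocycle hdegree b (PolynomialModule.single k 0 a) *
          polyEquiv hcocycle hdegree b (PolynomialModule.single k 0 c))).coeff 0,
      ((polyEquiv hcocycle hdegree b).symm
        (polyEquiv hcocycle hdegree b (PolynomialModule.single k 0 a) *
          polyEquiv hcocycle hdegree b (PolynomialModule.single k 0 c))).coeff 1⟩ :
      KappaExt hcocycle hdegree) = ⟨a * c, κ a c⟩ := by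
  rw [← map_polyExtend (toExt hcocycle hdegree) (toExt_X_smul hcocycle hdegree)
    (expansion hcocycle hdegree b) (toExt_expansion hcocycle hdegree b)]
  change toExt hcocycle hdegree (polyEquiv hcocycle hdegree b _) = _
  rw [LinearEquiv.apply_symm_apply, map_mul, polyEquiv_single, polyEquiv_single, toExt_expansion,
    toExt_expansion]
  ext1
  · rfl
  · rw [SquareZero.snd_mul, mul_zero, zero_mul, zero_add, zero_add]

theorem polyEquiv_one :
    polyEquiv hcocycle hdegree b (PolynomialModule.single k 0 1) = 1 := by
  rw [polyEquiv_single, expansion_one]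

/-- The deformation of `S(V) # G` with first multiplication map `κ`. -/
def deformation : Deformation k (Skew k G V) :=
  Deformation.ofEquiv (polyEquiv hcocycle hdegree b) (polyEquiv_one hcocycle hdegree b)
    fun a c => congrArg SquareZero.fst (coeff_polyEquiv_symm hcocycle hdegree b a c)

theorem mulMap_deformation : (deformation hcocycle hdegree b).mulMap 1 = κ := by
  refine LinearMap.ext₂ fun a c => ?_
  exact congrArg SquareZero.snd (coeff_polyEquiv_symm hcocycle hdegree b a c)

/-- The deformed algebra is the algebra with a central parameter. -/
def totalEquiv : (deformation hcocycle hdegree b).Total ≃ₐ[k[X]] ParamQuotient (vectorForm κ) :=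
  Deformation.totalEquiv (polyEquiv hcocycle hdegree b) (polyEquiv_one hcocycle hdegree b) _

theorem totalEquiv_single (a : Skew k G V) :
    totalEquiv hcocycle hdegree b (show (deformation hcocycle hdegree b).Total from
      PolynomialModule.single k 0 a) = expansion hcocycle hdegree b a :=
  polyEquiv_single hcocycle hdegree b a

end ParamQuotient

end Degree

end SkewGroupDeformation

end

/-! ### The fiber at t = 1 -/

noncomputable section

namespace SkewGroupDeformation

open Polynomial

section Fiber

variable {k : Type*} {G : Type*} {V : Type*} [Field k] [Group G] [AddCommGroup V] [Module k V]
  [DistribMulAction G V] [SMulCommClass G k V]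

namespace ParamQuotient

/-- The specialization of the central parameter to `1`. -/
def specialize (κ : V →ₗ[k] V →ₗ[k] MonoidAlgebra k G) : ParamQuotient κ →ₐ[k] SkewQuotient κ :=
  SkewQuotient.lift (SkewQuotient.vec κ) ((SkewQuotient.grp κ).comp (MonoidHom.fst _ _))
    (fun g v => SkewQuotient.grp_mul_vec κ g.1 v) fun v w => by
      rw [SkewQuotient.vec_mul_vec_sub, shiftForm_apply]
      induction κ v w using MonoidAlgebra.induction_linear with
      | zero => simp
      | add x y hx hy => rw [map_add, map_add, map_add, hx, hy]
      | single g c => rw [shift_single, MonoidAlgebra.lift_single, MonoidAlgebra.lift_single]; rfl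

theorem specialize_vec (κ : V →ₗ[k] V →ₗ[k] MonoidAlgebra k G) (v : V) :
    specialize κ (SkewQuotient.vec _ v) = SkewQuotient.vec κ v :=
  SkewQuotient.lift_vec _ _ _ _ v

theorem specialize_grp (κ : V →ₗ[k] V →ₗ[k] MonoidAlgebra k G) (g : G) :
    specialize κ (grp κ g) = SkewQuotient.grp κ g :=
  SkewQuotient.lift_grp _ _ _ _ _

theorem specialize_param (κ : V →ₗ[k] V →ₗ[k] MonoidAlgebra k G) :
    specialize κ (param κ) = 1 :=
  (SkewQuotient.lift_grp _ _ _ _ _).trans (map_one (SkewQuotient.grp κ))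

variable {κ : Skew k G V →ₗ[k] Skew k G V →ₗ[k] Skew k G V}
  (hcocycle : IsHochschildTwoCocycle κ) (hdegree : IsHomogeneousOfDegree κ (-2))
  {d : ℕ} (b : Module.Basis (Fin d) k V)

/-- The projection from the algebra with a central parameter to the fiber at `1`. -/
def projFiber : ParamQuotient (vectorForm κ) →ₐ[k] (deformation hcocycle hdegree b).Fiber 1 :=
  (RingQuot.mkAlgHom k _).comp
    ((totalEquiv hcocycle hdegree b).symm.toAlgHom.restrictScalars k)

theorem projFiber_totalEquiv (x : (deformation hcocycle hdegree b).Total) :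
    projFiber hcocycle hdegree b (totalEquiv hcocycle hdegree b x) =
      RingQuot.mkAlgHom k _ x :=
  congrArg (RingQuot.mkAlgHom k _) ((totalEquiv hcocycle hdegree b).symm_apply_apply x)

theorem projFiber_vec (v : V) : projFiber hcocycle hdegree b (SkewQuotient.vec _ v) =
    (deformation hcocycle hdegree b).toFiber 1 (vec k G v) := by
  rw [← expansion_vec hcocycle hdegree b, ← totalEquiv_single, projFiber_totalEquiv]
  rfl

theorem projFiber_grp (g : G) : projFiber hcocycle hdegree b (grp _ g) =
    (deformation hcocycle hdegree b).toFiber 1 (Skew.grp k V g) := by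
  rw [← expansion_grp hcocycle hdegree b, ← totalEquiv_single, projFiber_totalEquiv]
  rfl

/-- The parameter corresponds to X in A[t], which the fiber identifies with C 1 = 1. -/
theorem projFiber_param : projFiber hcocycle hdegree b (param _) = 1 := by
  have h : totalEquiv hcocycle hdegree b (algebraMap k[X] _ X) = param _ := by
    rw [AlgEquiv.commutes, algebraMap_eq, aeval_X]
  have h1 : algebraMap k[X] (deformation hcocycle hdegree b).Total (C 1) = 1 := by
    rw [C_1, map_one]
  rw [← h, projFiber_totalEquiv]
  exact (RingQuot.mkAlgHom_rel k ⟨rfl, rfl⟩).trans ((congrArg _ h1).trans (map_one _))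

/-- The map from `H_{0,κ}` to the fiber at `1`. -/
def toFiberHom : SkewQuotient (vectorForm κ) →ₐ[k] (deformation hcocycle hdegree b).Fiber 1 :=
  SkewQuotient.lift
    ((projFiber hcocycle hdegree b).toLinearMap ∘ₗ SkewQuotient.vec (shiftForm (vectorForm κ)))
    ((projFiber hcocycle hdegree b : ParamQuotient (vectorForm κ) →* _).comp (grp (vectorForm κ)))
    (fun g v => by
      have h := SkewQuotient.grp_mul_vec (shiftForm (vectorForm κ)) (g, 1) v
      have h1 := congrArg (projFiber hcocycle hdegree b) h
      rwa [map_mul, map_mul] at h1)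
    fun v w => by
      have h := congrArg (projFiber hcocycle hdegree b) (vec_mul_vec_sub (vectorForm κ) v w)
      rw [map_sub, map_mul, map_mul, map_mul, projFiber_param, one_mul] at h
      refine h.trans ?_
      induction vectorForm κ v w using MonoidAlgebra.induction_linear with
      | zero => rw [map_zero, map_zero, map_zero]
      | add x y hx hy => rw [map_add, map_add, map_add, hx, hy]
      | single g c => rw [MonoidAlgebra.lift_single, MonoidAlgebra.lift_single, map_smul]; rfl

theorem toFiberHom_vec (v : V) : toFiberHom hcocycle hdegree b (SkewQuotient.vec _ v) =
    (deformation hcocycle hdegree b).toFiber 1 (vec k G v) :=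
  (SkewQuotient.lift_vec _ _ _ _ v).trans (projFiber_vec hcocycle hdegree b v)

theorem toFiberHom_grp (g : G) : toFiberHom hcocycle hdegree b (SkewQuotient.grp _ g) =
    (deformation hcocycle hdegree b).toFiber 1 (Skew.grp k V g) :=
  (SkewQuotient.lift_grp _ _ _ _ g).trans (projFiber_grp hcocycle hdegree b g)

/-- Both maps send t to 1 and agree on V and G. With this, one of the two inverse identities for
`fiberEquiv` follows without inspecting the elements of the fiber. -/
theorem toFiberHom_comp_specialize :
    (toFiberHom hcocycle hdegree b).comp (specialize _) = projFiber hcocycle hdegree b := by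
  refine SkewQuotient.hom_ext (fun v => ?_) fun ⟨g, n⟩ => ?_
  · rw [AlgHom.comp_apply, specialize_vec, toFiberHom_vec, projFiber_vec]
  · rw [← ofAdd_toAdd n, ← grp_mul_param_pow, map_mul, map_mul, map_pow, map_pow, projFiber_param,
      AlgHom.comp_apply, AlgHom.comp_apply, specialize_grp, specialize_param,
      map_one (toFiberHom hcocycle hdegree b), toFiberHom_grp, projFiber_grp]

/-- The map from the fiber at `1` to `H_{0,κ}`. -/
def ofFiberHom : (deformation hcocycle hdegree b).Fiber 1 →ₐ[k] SkewQuotient (vectorForm κ) :=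
  RingQuot.liftAlgHom k ⟨(specialize _).comp
    ((totalEquiv hcocycle hdegree b).toAlgHom.restrictScalars k), by
      rintro _ _ ⟨rfl, rfl⟩
      change specialize _ (totalEquiv hcocycle hdegree b _) =
        specialize _ (totalEquiv hcocycle hdegree b _)
      rw [AlgEquiv.commutes, AlgEquiv.commutes, algebraMap_eq, aeval_X, specialize_param, C_1,
        map_one, map_one]⟩

theorem ofFiberHom_mk (x : (deformation hcocycle hdegree b).Total) :
    ofFiberHom hcocycle hdegree b (RingQuot.mkAlgHom k _ x) =
      specialize _ (totalEquiv hcocycle hdegree b x) :=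
  RingQuot.liftAlgHom_mkAlgHom_apply ..

/-- The isomorphism of `H_{0,κ}` with the fiber at `1`. -/
def fiberEquiv : SkewQuotient (vectorForm κ) ≃ₐ[k] (deformation hcocycle hdegree b).Fiber 1 :=
  AlgEquiv.ofAlgHom (toFiberHom hcocycle hdegree b) (ofFiberHom hcocycle hdegree b)
    (by
      apply RingQuot.ringQuot_ext'
      ext x
      change toFiberHom hcocycle hdegree b
        (ofFiberHom hcocycle hdegree b (RingQuot.mkAlgHom k _ x)) = RingQuot.mkAlgHom k _ x
      rw [ofFiberHom_mk, ← AlgHom.comp_apply, toFiberHom_comp_specialize, projFiber_totalEquiv])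
    (SkewQuotient.hom_ext
      (fun v => by
        rw [AlgHom.comp_apply, toFiberHom_vec]
        refine (ofFiberHom_mk hcocycle hdegree b _).trans ?_
        rw [totalEquiv_single, expansion_vec, specialize_vec]; rfl)
      (fun g => by
        rw [AlgHom.comp_apply, toFiberHom_grp]
        refine (ofFiberHom_mk hcocycle hdegree b _).trans ?_
        rw [totalEquiv_single, expansion_grp, specialize_grp]; rfl))

end ParamQuotient

end Fiber

end SkewGroupDeformation

end

theorem mainTheorem6 {k G V : Type*} [Field k] [Group G] [Finite G] [AddCommGroup V] [Module k V]
    [FiniteDimensional k V] [DistribMulAction G V] [SMulCommClass G k V]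
    (κ : Skew k G V →ₗ[k] Skew k G V →ₗ[k] Skew k G V)
    (hcocycle : IsHochschildTwoCocycle κ) (hdegree : IsHomogeneousOfDegree κ (-2)) :
    ∃ κ₀ : V →ₗ[k] V →ₗ[k] MonoidAlgebra k G,
      κ₀.IsAlt ∧
      (∀ v w : V, groupIncl k G V (κ₀ v w)
        = κ (vec k G v) (vec k G w) - κ (vec k G w) (vec k G v)) ∧
      Hecke.HasPBW (0 : MonoidAlgebra k G →ₗ[k] V →ₗ[k] MonoidAlgebra k G) κ₀ ∧
      ∃ D : Deformation k (Skew k G V),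
        D.mulMap 1 = κ ∧
        ∃ e : Hecke (0 : MonoidAlgebra k G →ₗ[k] V →ₗ[k] MonoidAlgebra k G) κ₀ ≃ₐ[k] D.Fiber 1,
          (∀ v : V, e (Hecke.gen 0 κ₀ (Sum.inl v)) = D.toFiber 1 (vec k G v)) ∧
          (∀ g : G, e (Hecke.gen 0 κ₀ (Sum.inr g))
            = D.toFiber 1 (groupIncl k G V (MonoidAlgebra.single g 1))) := by
  let b := Module.finBasis k V
  refine ⟨vectorForm κ, vectorForm_self, groupIncl_vectorForm hdegree,
    Hecke.hasPBW (isPBWForm_vectorForm hcocycle hdegree), ParamQuotient.deformation hcocycle hdegree b,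
    ParamQuotient.mulMap_deformation hcocycle hdegree b,
    (Hecke.equivSkewQuotient _).trans (ParamQuotient.fiberEquiv hcocycle hdegree b),
    fun v => ?_, fun g => ?_⟩
  · rw [AlgEquiv.trans_apply, Hecke.equivSkewQuotient_gen]
    exact ParamQuotient.toFiberHom_vec hcocycle hdegree b v
  · rw [AlgEquiv.trans_apply, Hecke.equivSkewQuotient_gen, Skew.groupIncl_single]
    exact ParamQuotient.toFiberHom_grp hcocycle hdegree b g
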